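/- Let $d\ge 1$ and $b\ge 2$ be integers, and let $H:[0,1]\to[0,1]^d$ be Hilbert's space filling curve, the limit of the recursive curves given by Butz's (binary reflected Gray code) construction; for $d=1$, $H(x)=x$. For $i\ge 1$ write $i-1=\sum_{j\ge1}a_{ij}b^{j-1}$ with digits $a_{ij}\in\{0,\dots,b-1\}$, so that $\sum_{j\ge 1} a_{ij}b^{-j}$ is the $i$-th point of the van der Corput sequence in base $b$. Let $$x_i=\sum_{j\ge1}\pi_{a_{i1}\dots a_{i,j-1}}(a_{ij})\,b^{-j}$$ be its nested uniform scrambling, where the permutations $\pi_s$, one for each finite string $s$ of digits, are independent and each uniformly distributed on the $b!$ permutations of $\{0,\dots,b-1\}$. For $f:[0,1]^d\to\mathbb R$ put $$\mu=\int_{[0,1]^d}f(X)\,dX,\qquad \hat\mu_n=\frac1n\sum_{i=1}^n f(H(x_i)).$$ Assume that $f\in C^1([0,1]^d)$ and that $\sigma^2=\int_{[0,1]^d}\|\nabla f(X)\|^2\,dX>0$, with $\|\cdot\|$ the Euclidean norm. Consider sample sizes $n=b^m$, $m=0,1,2,\dots$. Then: 1. for all sufficiently large $n=b^m$, $$\mathrm{Var}(\hat\mu_n)\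 \ge\ \frac{\sigma^2}{96}\,2^{-2/d-d}\,n^{-1-2/d};$$ 2. this is the rate of the upper bound: if $f$ is Lipschitz on $[0,1]^d$ with constant $M$ for the Euclidean norm, then for every $n=b^m$, $$\mathrm{Var}(\hat\mu_n)\ \le\ 4M^2(d+3)\,n^{-1-2/d};$$ 3. as $n=b^m\to\infty$, $$\frac{\hat\mu_n-\mu}{\sqrt{\mathrm{Var}(\hat\mu_n)}}\ \to\ N(0,1)\quad\text{in distribution}.$$ -/

import Mathlib

open MeasureTheory ProbabilityTheory Filter Topology
open scoped NNReal ENNReal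

noncomputable section

namespace HSFC

/-! ### The unit cube -/

/-- The closed unit cube `[0,1]^d` in `ℝ^d` (Euclidean norm, Lebesgue measure). -/
def unitCube (d : ℕ) : Set (EuclideanSpace ℝ (Fin d)) :=
  {x | ∀ i, x i ∈ Set.Icc (0 : ℝ) 1}

/-! ### Hilbert's space filling curve in dimension `d ≥ 1`

The cube is cut into `2^d` congruent subcubes of side `1/2`, visited in the order of the binary
reflected Gray code: bit `i` of `gray w` says whether the `w`-th subcube is in the lower or the
upper half in direction `i`. In the `w`-th subcube the curve is a copy of the whole curve, scaled
by `1/2` and moved by a symmetry of the cube (a rotation of the coordinate axes followed by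
reflections) chosen so that each copy ends at the vertex where the next one starts. The whole curve
goes from the vertex `(0,…,0)` to the vertex `(0,…,0,1)`. -/

/-- The binary reflected Gray code. -/
def gray (w : ℕ) : ℕ := w ^^^ (w >>> 1)

/-- The vertex, coded by its bits, at which the `w`-th copy of the curve enters its subcube:
`0` for `w = 0`, and `gray (2 * ⌊(w - 1) / 2⌋)` for `w ≥ 1`. -/
def entryVertex (w : ℕ) : ℕ := gray (2 * ((w - 1) / 2))

/-- The direction (taken modulo `d`) of the edge joining the entry vertex and the exit vertex of the
`w`-th copy: the exponent of `2` in `w` (for `w` even) or in `w + 1` (for `w` odd), and `0` for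
`w = 0`. -/
def exitDirection (w : ℕ) : ℕ := padicValNat 2 (2 * ((w + 1) / 2))

/-- The similarity with ratio `1/2` that carries the unit cube, with the whole curve in it, to the
`w`-th subcube with the `w`-th copy of the curve in it. -/
def hilbertSimilarity {d : ℕ} [NeZero d] (w : ℕ) (y : EuclideanSpace ℝ (Fin d)) :
    EuclideanSpace ℝ (Fin d) :=
  WithLp.toLp 2 fun i =>
    ((if (gray w).testBit i then (1 : ℝ) else 0) +
      (if (entryVertex w).testBit i then 1 - y (i - Fin.ofNat d (exitDirection w + 1))
        else y (i - Fin.ofNat d (exitDirection w + 1)))) / 2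

/-- The number `w ∈ {0, …, 2^d - 1}` of the interval `[w/2^d, (w+1)/2^d]` that contains
`x ∈ [0,1]` (the right one of two intervals at a common endpoint). -/
def cellIndex (d : ℕ) (x : ℝ) : ℕ := min ⌊(2 : ℝ) ^ d * x⌋₊ (2 ^ d - 1)

/-- The recursive curves. Stage `0` is the edge from `(0,…,0)` to `(0,…,0,1)`; stage `k + 1` runs,
on the `w`-th interval of length `2^{-d}`, through the image of stage `k` in the `w`-th subcube. -/
def hilbertStage {d : ℕ} [NeZero d] : ℕ → ℝ → EuclideanSpace ℝ (Fin d)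
  | 0, x => WithLp.toLp 2 fun i => if (i : ℕ) + 1 = d then x else 0
  | k + 1, x => hilbertSimilarity (cellIndex d x)
      (hilbertStage k ((2 : ℝ) ^ d * x - cellIndex d x))

/-- Hilbert's space filling curve `H : [0,1] → [0,1]^d`, the limit of the recursive curves. -/
def hilbertCurve (d : ℕ) [NeZero d] (x : ℝ) : EuclideanSpace ℝ (Fin d) :=
  limUnder atTop fun k : ℕ => (hilbertStage k x : EuclideanSpace ℝ (Fin d))

lemma rescale_mem {d : ℕ} {x : ℝ} (hx : x ∈ Set.Icc (0 : ℝ) 1) :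
    (2 : ℝ) ^ d * x - cellIndex d x ∈ Set.Icc (0 : ℝ) 1 := by
  obtain ⟨h0, h1⟩ := hx
  have hp : (0 : ℝ) < 2 ^ d := by positivity
  have hnn : (0 : ℝ) ≤ 2 ^ d * x := by positivity
  have hle := Nat.floor_le hnn
  have hlt := Nat.lt_floor_add_one ((2 : ℝ) ^ d * x)
  have h2 : ((2 ^ d - 1 : ℕ) : ℝ) = 2 ^ d - 1 := by
    rw [Nat.cast_sub Nat.one_le_two_pow]; simp
  unfold cellIndex
  constructor
  · have : ((min ⌊(2 : ℝ) ^ d * x⌋₊ (2 ^ d - 1) : ℕ) : ℝ) ≤ ⌊(2 : ℝ) ^ d * x⌋₊ :=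
      Nat.cast_le.2 (min_le_left _ _)
    linarith
  · rcases min_choice ⌊(2 : ℝ) ^ d * x⌋₊ (2 ^ d - 1) with h | h <;> rw [h]
    · linarith
    · rw [h2]; nlinarith

lemma hilbertStage_mem {d : ℕ} [NeZero d] (k : ℕ) : ∀ x ∈ Set.Icc (0 : ℝ) 1,
    (hilbertStage k x : EuclideanSpace ℝ (Fin d)) ∈ unitCube d := by
  induction k with
  | zero =>
    intro x hx i
    simp only [hilbertStage]
    split_ifs
    · exact hx
    · simp
  | succ k ih =>
    intro x hx i
    have h := ih _ (rescale_mem (d := d) hx)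
      (i - Fin.ofNat d (exitDirection (cellIndex d x) + 1))
    simp only [Set.mem_Icc] at h
    simp only [hilbertStage, hilbertSimilarity, Set.mem_Icc]
    split_ifs <;> constructor <;> linarith [h.1, h.2]

lemma hilbertStage_dist {d : ℕ} [NeZero d] (k : ℕ) : ∀ x ∈ Set.Icc (0 : ℝ) 1, ∀ i : Fin d,
    |(hilbertStage k x : EuclideanSpace ℝ (Fin d)) i - hilbertStage (k + 1) x i|
      ≤ 1 * (1 / 2 : ℝ) ^ k := by
  induction k with
  | zero =>
    intro x hx i
    have h1 := hilbertStage_mem (d := d) 0 x hx i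
    have h2 := hilbertStage_mem (d := d) 1 x hx i
    simp only [Set.mem_Icc] at h1 h2
    rw [abs_le]
    constructor <;> simp only [pow_zero, zero_add] <;> linarith [h1.1, h1.2, h2.1, h2.2]
  | succ k ih =>
    intro x hx i
    have h := ih _ (rescale_mem (d := d) hx)
      (i - Fin.ofNat d (exitDirection (cellIndex d x) + 1))
    rw [hilbertStage, hilbertStage, pow_succ]
    simp only [hilbertSimilarity]
    rw [abs_le] at h ⊢
    split_ifs <;> constructor <;> linarith [h.1, h.2]

/-- The recursive curves converge, so that `hilbertCurve` is a genuine limit. -/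
theorem tendsto_hilbertStage {d : ℕ} [NeZero d] {x : ℝ} (hx : x ∈ Set.Icc (0 : ℝ) 1) :
    Tendsto (fun k : ℕ => (hilbertStage k x : EuclideanSpace ℝ (Fin d))) atTop
      (𝓝 (hilbertCurve d x)) := by
  have h : ∀ i : Fin d, ∃ a : ℝ,
      Tendsto (fun k : ℕ => (hilbertStage k x : EuclideanSpace ℝ (Fin d)) i) atTop (𝓝 a) :=
    fun i => cauchySeq_tendsto_of_complete
      (cauchySeq_of_le_geometric (1 / 2 : ℝ) 1 (by norm_num)
        (fun k => by rw [Real.dist_eq]; exact hilbertStage_dist k x hx i))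
  choose a ha using h
  refine tendsto_nhds_limUnder ⟨WithLp.toLp 2 a, ?_⟩
  have := ((PiLp.continuous_toLp 2 (fun _ : Fin d => ℝ)).tendsto a).comp
    (tendsto_pi_nhds.2 ha)
  exact this

/-- In dimension one the curve is the identity. -/
theorem hilbertCurve_one {x : ℝ} (hx : x ∈ Set.Icc (0 : ℝ) 1) :
    hilbertCurve 1 x = WithLp.toLp 2 fun _ => x := by
  have key : ∀ k : ℕ, ∀ x ∈ Set.Icc (0 : ℝ) 1,
      (hilbertStage k x : EuclideanSpace ℝ (Fin 1)) = WithLp.toLp 2 fun _ => x := by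
    intro k
    induction k with
    | zero => intro x _; simp [hilbertStage]
    | succ k ih =>
      intro x hx
      rw [hilbertStage, ih _ (rescale_mem hx)]
      have hw : cellIndex 1 x ≤ 1 := by simp [cellIndex]
      ext i
      obtain rfl : i = 0 := Subsingleton.elim _ _
      interval_cases h : cellIndex 1 x <;>
        simp [hilbertSimilarity, gray, entryVertex]
  have h := tendsto_hilbertStage (d := 1) hx
  simp only [key _ x hx] at h
  exact (tendsto_nhds_unique h tendsto_const_nhds)

/-! ### The scrambled van der Corput sequence and the estimate -/

/-- The digit of `b^{-(j+1)}` in the `i`-th point (`i = 0, 1, 2, …`) of the van der Corput sequence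
in base `b`, that is, the digit of `b^j` in the base `b` expansion of `i`. -/
def vdcDigit (b : ℕ) [NeZero b] (i j : ℕ) : Fin b := Fin.ofNat b (i / b ^ j)

/-- The `i`-th point of the van der Corput sequence in base `b` after the nested scrambling with the
permutations `π s`, indexed by finite strings `s` of digits: its `j`-th digit is
`π (a₀ … a_{j-1}) a_j`, where `a₀, a₁, …` are the digits of the unscrambled point. -/
def scrambledPoint {b : ℕ} [NeZero b] (π : List (Fin b) → Equiv.Perm (Fin b)) (i : ℕ) : ℝ :=
  ∑' j : ℕ,
    ((π (List.ofFn fun k : Fin j => vdcDigit b i k) (vdcDigit b i j) : ℕ) : ℝ) / (b : ℝ) ^ (j + 1)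

/-- The random permutations of a nested uniform scrambling in base `b`: one for each finite string
of digits, each uniform on the `b!` permutations of the digits, all mutually independent. -/
structure IsNestedUniformScrambling {b : ℕ} {Ω : Type*} [MeasurableSpace Ω] (P : Measure Ω)
    (π : List (Fin b) → Ω → Equiv.Perm (Fin b)) : Prop where
  measurableSet : ∀ s τ, MeasurableSet {ω | π s ω = τ}
  uniform : ∀ s τ, P {ω | π s ω = τ} = (b.factorial : ℝ≥0∞)⁻¹
  indep : iIndepFun (m := fun _ => ⊤) π P

/-- The estimate `(1/n) ∑ f (H (x_i))` over the first `n` points `x_i` of the scrambled van der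
Corput sequence, as a random variable. -/
def estimate {d b : ℕ} [NeZero d] [NeZero b] {Ω : Type*} (f : EuclideanSpace ℝ (Fin d) → ℝ)
    (π : List (Fin b) → Ω → Equiv.Perm (Fin b)) (n : ℕ) (ω : Ω) : ℝ :=
  (1 / (n : ℝ)) *
    ∑ i ∈ Finset.range n, f (hilbertCurve d (scrambledPoint (fun s => π s ω) i))

end HSFC

end

open MeasureTheory ProbabilityTheory Filter Topology
open scoped NNReal ENNReal

noncomputable section

namespace HSFC

/-! ### The uniform distribution on the unit interval -/

/-! The first n = b^m scrambled points form a stratified sample: exactly one point in each interval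
of length 1/n, with independent and uniform positions (`IsNestedUniformScrambling.map_positions`).
Indeed the permutations at depth below m only permute the intervals, while the digits beyond the
m-th come from permutations at distinct deeper nodes. Hence the variance is n^{-2} times the sum of
the variances of f ∘ H over the n strata, and everything reduces to the local behaviour of f ∘ H.

Two facts about H are used. On each of the 2^{dj} closed intervals of level j it is a copy of itself
under a similarity of ratio 2^{-j} (`exists_isDyadicSimilarity`), which rests on the Gray-code
identity that each copy ends where the next begins (`exit_bit_add_eq`). And it carries Lebesgue
measure to Lebesgue measure (`map_extendedCurve`), since both laws on the cube are fixed by the same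
average of contractions, which has only one fixed law (`eq_of_selfSimilar`).

Upper bound: an interval of length 1/n meets at most two neighbouring cells of a level with 2^{dj} ≤
n < 2^{d(j+1)}, so H stays within 2√d n^{-1/d} of one point there, and the oscillation of a
Lipschitz f bounds each stratum variance.

Lower bound: at a level with 2n ≤ 2^{dj} ≤ 2^{d+1} n every stratum contains one or two whole cells.
Their images are whole subcubes of side 2^{-j}, on which f is almost affine, and an affine function
with gradient g has variance 4^{-j}‖g‖²/12 there (`cell_lower_bound`). Summed over the strata, ‖g‖²
averages to σ² because H preserves measure.

Normality: the centred summands are O(n^{-1/d}), while the lower bound makes n√Var at least of order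
n^{1/2-1/d}. The standardized summands are thus uniformly O(n^{-1/2}), and the characteristic
functions converge by `norm_charFun_sum_sub_exp_le`. -/

/-- The uniform distribution on `[0,1]`. -/
def unif : Measure ℝ := volume.restrict (Set.Icc 0 1)

instance : IsProbabilityMeasure unif := ⟨by simp [unif]⟩

lemma ae_unif_mem : ∀ᵐ x ∂unif, x ∈ Set.Icc (0 : ℝ) 1 :=
  ae_restrict_mem measurableSet_Icc

lemma integral_unif (g : ℝ → ℝ) : ∫ x, g x ∂unif = ∫ x in (0 : ℝ)..1, g x := by
  rw [unif, integral_Icc_eq_integral_Ioc, intervalIntegral.integral_of_le zero_le_one]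

lemma integrable_unif_iff {g : ℝ → ℝ} :
    Integrable g unif ↔ IntervalIntegrable g volume 0 1 := by
  rw [intervalIntegrable_iff_integrableOn_Icc_of_le zero_le_one]; rfl

lemma add_div_mem_Icc {N k : ℕ} (hk : k < N) {x : ℝ} (hx : x ∈ Set.Icc (0 : ℝ) 1) :
    ((k : ℝ) + x) / N ∈ Set.Icc (0 : ℝ) 1 := by
  have hN : (0 : ℝ) < N := by exact_mod_cast (Nat.zero_le k).trans_lt hk
  have hk' : (k : ℝ) + 1 ≤ N := by exact_mod_cast hk
  constructor
  · have := hx.1; positivity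
  · rw [div_le_one hN]; linarith [hx.2]

lemma integral_unif_comp_add_div {N : ℕ} (hN : 0 < N) (k : ℕ) (g : ℝ → ℝ) :
    ∫ x, g (((k : ℝ) + x) / N) ∂unif = N * ∫ x in ((k : ℝ) / N)..((k + 1 : ℕ) : ℝ) / N, g x := by
  have hN' : (N : ℝ) ≠ 0 := by positivity
  rw [integral_unif]
  have := intervalIntegral.integral_comp_div_add (a := 0) (b := 1) g hN' ((k : ℝ) / N)
  simp only [smul_eq_mul, zero_div, zero_add] at this
  rw [show ((k + 1 : ℕ) : ℝ) / N = 1 / N + k / N by push_cast; ring, ← this]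
  congr 1; ext x; congr 1; ring

lemma intervalIntegrable_cell {g : ℝ → ℝ} (hg : Integrable g unif) {N k : ℕ} (hk : k < N) :
    IntervalIntegrable g volume ((k : ℝ) / N) (((k + 1 : ℕ) : ℝ) / N) := by
  have h0 := add_div_mem_Icc hk (x := 0) (by simp)
  have h1 := add_div_mem_Icc hk (x := 1) (by simp)
  refine (integrable_unif_iff.1 hg).mono_set ?_
  rw [Set.uIcc_of_le zero_le_one, Nat.cast_succ]
  exact Set.ordConnected_Icc.uIcc_subset (by simpa using h0) h1

/-- The uniform distribution is the average of its copies on `N` intervals of equal length. -/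
lemma integral_unif_eq_avg {N : ℕ} (hN : 0 < N) {g : ℝ → ℝ} (hg : Integrable g unif) :
    ∫ x, g x ∂unif = ∑ k ∈ Finset.range N, (1 / (N : ℝ)) * ∫ x, g (((k : ℝ) + x) / N) ∂unif := by
  have hN' : (N : ℝ) ≠ 0 := by positivity
  have := intervalIntegral.sum_integral_adjacent_intervals (μ := volume) (f := g)
    (a := fun k : ℕ => (k : ℝ) / N) (n := N) fun k hk => intervalIntegrable_cell hg hk
  simp only [Nat.cast_zero, zero_div, div_self hN'] at this
  rw [integral_unif, ← this]
  refine Finset.sum_congr rfl fun k _ => ?_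
  rw [integral_unif_comp_add_div hN]; field_simp

/-! ### Uniqueness of self-similar distributions -/

lemma abs_integral_sub_le_of_lipschitz {E : Type*} [PseudoMetricSpace E] [MeasurableSpace E]
    [OpensMeasurableSpace E]
    {μ : Measure E} [IsProbabilityMeasure μ] {S : Set E} {x₀ : E} {C : ℝ}
    (hS : ∀ᵐ x ∂μ, x ∈ S) (hC : ∀ x ∈ S, dist x x₀ ≤ C)
    {f : E → ℝ} {L : ℝ≥0} (hf : LipschitzWith L f) :
    |(∫ x, f x ∂μ) - f x₀| ≤ L * C := by
  have hb : ∀ᵐ x ∂μ, ‖f x - f x₀‖ ≤ L * C := hS.mono fun x hx => by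
    rw [← dist_eq_norm]
    exact (hf.dist_le_mul _ _).trans (mul_le_mul_of_nonneg_left (hC x hx) L.2)
  have hi : Integrable (fun x => f x - f x₀) μ :=
    Integrable.of_bound (hf.continuous.measurable.sub_const _).aestronglyMeasurable _ hb
  have hif : Integrable f μ :=
    (hi.add (integrable_const (f x₀))).congr (ae_of_all _ fun x => by simp)
  have h := norm_integral_le_of_norm_le_const hb
  rw [integral_sub hif (integrable_const _)] at h
  simpa using h

/-- Portmanteau: agreement on Lipschitz functions says that the constant sequence μ converges weakly
to ν. This extends the agreement to bounded continuous functions, which determine a finite Borel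
measure. -/
lemma ext_of_forall_integral_lipschitz {E : Type*} [PseudoMetricSpace E] [MeasurableSpace E]
    [BorelSpace E] {μ ν : Measure E} [IsProbabilityMeasure μ] [IsProbabilityMeasure ν]
    (h : ∀ f : E → ℝ, (∃ L, LipschitzWith L f) → ∫ x, f x ∂μ = ∫ x, f x ∂ν) : μ = ν := by
  let μ' : ProbabilityMeasure E := ⟨μ, inferInstance⟩
  let ν' : ProbabilityMeasure E := ⟨ν, inferInstance⟩
  have h1 : Tendsto (fun _ : ℕ => μ') atTop (𝓝 ν') := by
    refine tendsto_iff_forall_lipschitz_integral_tendsto.2 fun f _ hf => ?_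
    simp only [μ', ν', ProbabilityMeasure.coe_mk, h f hf]
    exact tendsto_const_nhds
  refine ext_of_forall_lintegral_eq_of_IsFiniteMeasure fun f => ?_
  have h2 := (ProbabilityMeasure.tendsto_iff_forall_lintegral_tendsto.1 h1) f
  exact tendsto_nhds_unique tendsto_const_nhds h2

/-- Two distributions on a bounded set that are invariant under the same finite average of
contractions are equal. -/
theorem eq_of_selfSimilar {E ι : Type*} [PseudoMetricSpace E] [MeasurableSpace E] [BorelSpace E]
    {μ ν : Measure E} [IsProbabilityMeasure μ] [IsProbabilityMeasure ν]
    {S : Set E} (hSb : Bornology.IsBounded S)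
    (hμS : ∀ᵐ x ∂μ, x ∈ S) (hνS : ∀ᵐ x ∂ν, x ∈ S)
    (s : Finset ι) {p : ℝ} (hp : 0 ≤ p) (hps : ∑ _w ∈ s, p = 1) {q : ℝ≥0} (hq : q < 1)
    {T : ι → E → E} (hT : ∀ w ∈ s, LipschitzWith q (T w))
    (hμ : ∀ f : E → ℝ, (∃ L, LipschitzWith L f) →
      ∫ x, f x ∂μ = ∑ w ∈ s, p * ∫ x, f (T w x) ∂μ)
    (hν : ∀ f : E → ℝ, (∃ L, LipschitzWith L f) →
      ∫ x, f x ∂ν = ∑ w ∈ s, p * ∫ x, f (T w x) ∂ν) : μ = ν := by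
  obtain ⟨x₀, hx₀⟩ := hμS.exists
  obtain ⟨C, hC⟩ := hSb.subset_closedBall x₀
  have key : ∀ j : ℕ, ∀ L : ℝ≥0, ∀ f : E → ℝ, LipschitzWith L f →
      |(∫ x, f x ∂μ) - ∫ x, f x ∂ν| ≤ 2 * L * C * (q : ℝ) ^ j := by
    intro j
    induction j with
    | zero =>
      intro L f hf
      have h1 := abs_integral_sub_le_of_lipschitz hμS (fun x hx => hC hx) hf
      have h2 := abs_integral_sub_le_of_lipschitz hνS (fun x hx => hC hx) hf
      rw [abs_le] at *
      constructor <;> linarith [h1.1, h1.2, h2.1, h2.2]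
    | succ j ih =>
      intro L f hf
      -- One use of the invariance replaces f by the functions f ∘ T w, whose Lipschitz constant is
      -- smaller by the factor q.
      rw [hμ f ⟨L, hf⟩, hν f ⟨L, hf⟩, ← Finset.sum_sub_distrib]
      refine (Finset.abs_sum_le_sum_abs _ _).trans ?_
      calc _ ≤ ∑ _w ∈ s, p * (2 * L * C * (q : ℝ) ^ (j + 1)) := by
            refine Finset.sum_le_sum fun w hw => ?_
            rw [← mul_sub, abs_mul, abs_of_nonneg hp]
            refine mul_le_mul_of_nonneg_left ?_ hp
            refine (ih (L * q) _ (hf.comp (hT w hw))).trans (le_of_eq ?_)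
            push_cast; ring
        _ = _ := by rw [← Finset.sum_mul, hps, one_mul]
  refine ext_of_forall_integral_lipschitz fun f ⟨L, hf⟩ => ?_
  have hlim : Tendsto (fun j : ℕ => 2 * L * C * (q : ℝ) ^ j) atTop (𝓝 0) := by
    simpa using (tendsto_pow_atTop_nhds_zero_of_lt_one q.2 hq).const_mul (2 * L * C)
  have := ge_of_tendsto' hlim fun j => key j L f hf
  exact sub_eq_zero.1 (abs_nonpos_iff.1 this)

/-! ### Random digits -/

/-- The uniform distribution on the digits. -/
def unifDigit (b : ℕ) [NeZero b] : Measure (Fin b) := uniformOn Set.univ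

instance (b : ℕ) [NeZero b] : IsProbabilityMeasure (unifDigit b) := by
  unfold unifDigit; infer_instance

lemma unifDigit_singleton {b : ℕ} [NeZero b] (a : Fin b) : unifDigit b {a} = (b : ℝ≥0∞)⁻¹ := by
  simp [unifDigit, uniformOn_univ]

lemma integral_unifDigit {b : ℕ} [NeZero b] (g : Fin b → ℝ) :
    ∫ a, g a ∂(unifDigit b) = ∑ a, (1 / (b : ℝ)) * g a := by
  rw [integral_fintype .of_finite]
  simp [measureReal_def, unifDigit_singleton]

lemma measurable_ofDigits {b : ℕ} : Measurable (Real.ofDigits : (ℕ → Fin b) → ℝ) := by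
  unfold Real.ofDigits Real.ofDigitsTerm
  refine Measurable.tsum fun j => ?_
  exact Measurable.mul_const ((measurable_of_finite fun a : Fin b => ((a : ℕ) : ℝ)).comp
    (measurable_pi_apply j)) _

lemma ofDigits_eq_head_add_tail {b : ℕ} (a : ℕ → Fin b) :
    Real.ofDigits a = ((a 0 : ℕ) + Real.ofDigits fun j => a (j + 1)) / b := by
  rw [Real.ofDigits_eq_sum_add_ofDigits a 1]
  simp [Real.ofDigitsTerm]; ring

/-- Disjoint groups of independent random variables are independent. -/
lemma _root_.ProbabilityTheory.iIndepFun.indepFun_restrict {Ω ι : Type*} [MeasurableSpace Ω]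
    {P : Measure Ω} {β : ι → Type*} [∀ i, MeasurableSpace (β i)] {X : ∀ i, Ω → β i}
    (h : iIndepFun X P) (hX : ∀ i, Measurable (X i)) {S T : Set ι} (hST : Disjoint S T) :
    IndepFun (fun ω (s : S) => X s ω) (fun ω (t : T) => X t ω) P := by
  have key : ∀ U : Set ι, MeasurableSpace.comap (fun ω (s : U) => X s ω) MeasurableSpace.pi =
      ⨆ i ∈ U, MeasurableSpace.comap (X i) inferInstance := by
    intro U
    simp only [MeasurableSpace.pi, MeasurableSpace.comap_iSup, MeasurableSpace.comap_comp,
      Function.comp_def, iSup_subtype]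
  have h2 := indep_iSup_of_disjoint (fun j => (hX j).comap_le) h hST
  rw [IndepFun_iff_Indep, key, key]
  exact h2

/-- Source of the self-similarity of i.i.d. digits: the first digit selects an interval and the
shifted sequence, independent of it, has the original law. -/
lemma map_head_tail {b : ℕ} [NeZero b] :
    (Measure.infinitePi fun _ : ℕ => unifDigit b).map (fun a => (a 0, fun j => a (j + 1))) =
      (unifDigit b).prod (Measure.infinitePi fun _ : ℕ => unifDigit b) := by
  set ρ := Measure.infinitePi fun _ : ℕ => unifDigit b
  have hi : iIndepFun (fun (j : ℕ) (a : ℕ → Fin b) => a j) ρ :=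
    iIndepFun_infinitePi (X := fun _ a => a) fun _ => measurable_id
  have hm : ∀ j, Measurable fun a : ℕ → Fin b => a j := measurable_pi_apply
  have h3 : IndepFun (fun a : ℕ → Fin b => a 0) (fun a (j : ℕ) => a (j + 1)) ρ :=
    (hi.indepFun_restrict hm (S := {0}) (T := {j | 0 < j}) (by simp)).comp
      (φ := fun x : ({0} : Set ℕ) → Fin b => x ⟨0, rfl⟩)
      (ψ := fun (x : {j : ℕ | 0 < j} → Fin b) (j : ℕ) => x ⟨j + 1, j.succ_pos⟩)
      (by fun_prop) (by fun_prop)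
  rw [(indepFun_iff_map_prod_eq_prod_map_map (hm 0).aemeasurable
    (measurable_pi_lambda _ fun j => hm (j + 1)).aemeasurable).1 h3]
  congr 1
  · exact Measure.infinitePi_map_eval _ 0
  · exact Measure.map_infinitePi_infinitePi_of_inj (add_left_injective 1)

/-- A number with independent uniform digits is uniformly distributed on `[0,1]`. -/
theorem map_ofDigits {b : ℕ} [NeZero b] (hb : 2 ≤ b) :
    (Measure.infinitePi fun _ : ℕ => unifDigit b).map Real.ofDigits = unif := by
  have hb0 : 0 < b := by omega
  have hb' : (0 : ℝ) < b := by positivity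
  set ρ := Measure.infinitePi fun _ : ℕ => unifDigit b with hρ
  have hprob : IsProbabilityMeasure (ρ.map Real.ofDigits) :=
    Measure.isProbabilityMeasure_map measurable_ofDigits.aemeasurable
  have hlip : ∀ w ∈ Finset.range b, LipschitzWith (b : ℝ≥0)⁻¹ fun x : ℝ => ((w : ℝ) + x) / b := by
    intro w _
    refine LipschitzWith.of_dist_le_mul fun x y => ?_
    rw [Real.dist_eq, Real.dist_eq, ← sub_div, add_sub_add_left_eq_sub, abs_div, abs_of_pos hb']
    simp [div_eq_inv_mul]
  refine eq_of_selfSimilar (Metric.isBounded_Icc (0 : ℝ) 1) ?_ ae_unif_mem (Finset.range b)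
    (p := 1 / (b : ℝ)) (by positivity) ?_ (q := (b : ℝ≥0)⁻¹) ?_ hlip ?_ ?_
  · refine (ae_map_iff measurable_ofDigits.aemeasurable measurableSet_Icc).2 ?_
    exact ae_of_all _ fun a => ⟨Real.ofDigits_nonneg a, Real.ofDigits_le_one a⟩
  · simp [hb'.ne']
  · exact inv_lt_one_of_one_lt₀ (by exact_mod_cast hb)
  · rintro f ⟨L, hf⟩
    have hfm := hf.continuous.measurable
    have hbdd : ∀ w : ℕ, w < b → ∀ a : ℕ → Fin b,
        ‖f (((w : ℝ) + Real.ofDigits a) / b)‖ ≤ ‖f 0‖ + L := by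
      intro w hw a
      have h1 := add_div_mem_Icc hw ⟨Real.ofDigits_nonneg a, Real.ofDigits_le_one a⟩
      have h2 := hf.dist_le_mul (((w : ℝ) + Real.ofDigits a) / b) 0
      rw [dist_eq_norm, dist_zero_right, Real.norm_of_nonneg h1.1] at h2
      have h3 := norm_le_norm_add_norm_sub' (f (((w : ℝ) + Real.ofDigits a) / b)) (f 0)
      nlinarith [h1.2, L.2]
    rw [integral_map measurable_ofDigits.aemeasurable hfm.aestronglyMeasurable]
    have hsplit : ∫ a, f (Real.ofDigits a) ∂ρ =
        ∫ a : ℕ → Fin b, f (((a 0 : ℕ) + Real.ofDigits fun j => a (j + 1)) / b) ∂ρ := by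
      refine integral_congr_ae (ae_of_all _ fun a => ?_)
      simp only
      rw [ofDigits_eq_head_add_tail a]
    rw [hsplit]
    have hm : Measurable fun a : Fin b × (ℕ → Fin b) =>
        f (((a.1 : ℕ) + Real.ofDigits a.2) / b) := by
      have := measurable_ofDigits (b := b)
      have h2 : Measurable fun a : Fin b => ((a : ℕ) : ℝ) := measurable_of_finite _
      fun_prop
    have h := integral_map (μ := ρ) (φ := fun a => (a 0, fun j => a (j + 1)))
      (f := fun a : Fin b × (ℕ → Fin b) => f (((a.1 : ℕ) + Real.ofDigits a.2) / b))
      (by fun_prop) hm.aestronglyMeasurable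
    rw [← h, hρ, map_head_tail, integral_prod, integral_unifDigit, Finset.sum_range]
    · refine Finset.sum_congr rfl fun w _ => ?_
      rw [integral_map measurable_ofDigits.aemeasurable
        (Measurable.aestronglyMeasurable (by fun_prop))]
    · exact Integrable.of_bound hm.aestronglyMeasurable _ (ae_of_all _ fun a => hbdd a.1 a.1.2 a.2)
  · rintro f ⟨L, hf⟩
    exact integral_unif_eq_avg hb0
      (integrable_unif_iff.2 (hf.continuous.intervalIntegrable 0 1))

/-! ### Bits of the Gray code -/

lemma testBit_gray (w i : ℕ) : (gray w).testBit i = (w.testBit i ^^ w.testBit (i + 1)) := by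
  simp [gray, Nat.testBit_shiftRight, add_comm]

/-- Consecutive Gray codes differ in one bit. -/
lemma testBit_gray_succ (w : ℕ) : ∀ i : ℕ, (gray (w + 1)).testBit i =
    ((gray w).testBit i ^^ decide (i = padicValNat 2 (w + 1))) := by
  induction w using Nat.strong_induction_on with
  | _ w ih =>
    intro i
    rcases Nat.even_or_odd' w with ⟨u, rfl | rfl⟩
    · have h0 : padicValNat 2 (2 * u + 1) = 0 :=
        padicValNat.eq_zero_of_not_dvd (by omega)
      rw [h0, testBit_gray, testBit_gray]
      rcases i with _ | i
      · have h1 : (2 * u + 1).testBit 1 = (2 * u).testBit 1 := by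
          rw [Nat.testBit_succ, Nat.testBit_succ]; congr 1; omega
        rw [zero_add, h1]; simp
      · have h1 : ∀ j, (2 * u + 1).testBit (j + 1) = (2 * u).testBit (j + 1) := fun j => by
          rw [Nat.testBit_succ, Nat.testBit_succ]; congr 1; omega
        rw [h1, h1]; simp
    -- For odd w = 2u + 1, the bits of w and w + 1 above the lowest, and the exponent of 2 in w + 1,
    -- are those of u and u + 1 moved up by one place.
    · have h0 : padicValNat 2 (2 * u + 1 + 1) = padicValNat 2 (u + 1) + 1 := by
        rw [show 2 * u + 1 + 1 = 2 * (u + 1) by ring,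
          padicValNat.mul (by norm_num) (by omega)]
        simp [add_comm]
      have hs : ∀ j, (2 * u + 1 + 1).testBit (j + 1) = (u + 1).testBit j := fun j => by
        rw [Nat.testBit_succ]; congr 1; omega
      have hs' : ∀ j, (2 * u + 1).testBit (j + 1) = u.testBit j := fun j => by
        rw [Nat.testBit_succ]; congr 1; omega
      rw [h0, testBit_gray, testBit_gray, hs, hs']
      rcases i with _ | i
      · simp only [Nat.testBit_zero]
        have h1 : (2 * u + 1 + 1) % 2 = 0 := by omega
        have h2 : (2 * u + 1) % 2 = 1 := by omega
        rcases Nat.mod_two_eq_zero_or_one u with h | h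
        · have h3 : (u + 1) % 2 = 1 := by omega
          simp [h1, h2, h, h3]
        · have h3 : (u + 1) % 2 = 0 := by omega
          simp [h1, h2, h, h3]
      · rw [hs, hs']
        have := ih u (by omega) i
        rw [testBit_gray, testBit_gray] at this
        rw [this]; simp

/-- Except on the last copy, the reduction of the direction modulo d is therefore harmless. -/
lemma exitDirection_lt {d w : ℕ} (hw : w + 1 < 2 ^ d) : exitDirection w < d := by
  have h0 : 0 < d := by
    rcases d with _ | d
    · simp at hw
    · omega
  rcases Nat.eq_zero_or_pos w with rfl | hpos
  · simpa [exitDirection] using h0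
  by_contra hge
  have h1 : 2 ^ d ∣ 2 * ((w + 1) / 2) :=
    (pow_dvd_pow 2 (not_lt.1 hge)).trans pow_padicValNat_dvd
  have := Nat.le_of_dvd (by omega) h1
  omega

/-- The exit vertex of a copy of the curve is the entry vertex of the next copy, bit by bit. -/
lemma exit_bit_add_eq (w i : ℕ) :
    ((gray w).testBit i).toNat + ((entryVertex w).testBit i ^^ decide (i = exitDirection w)).toNat =
      ((gray (w + 1)).testBit i).toNat + ((entryVertex (w + 1)).testBit i).toNat := by
  rcases Nat.even_or_odd' w with ⟨u, rfl | rfl⟩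
  · rcases u with _ | u
    · have h1 := testBit_gray_succ 0 i
      have h2 : Nat.testBit 1 i = decide (i = 0) := by simpa [gray] using h1
      simp [entryVertex, exitDirection, h2, gray]
    · have e1 : entryVertex (2 * (u + 1)) = gray (2 * u) := by
        unfold entryVertex; congr 1; omega
      have e2 : entryVertex (2 * (u + 1) + 1) = gray (2 * u + 1 + 1) := by
        unfold entryVertex; congr 1; omega
      have e3 : exitDirection (2 * (u + 1)) = padicValNat 2 (2 * u + 1 + 1) := by
        unfold exitDirection; congr 1; omega
      have hv : padicValNat 2 (2 * (u + 1) + 1) = 0 :=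
        padicValNat.eq_zero_of_not_dvd (by omega)
      have hv' : padicValNat 2 (2 * u + 1) = 0 :=
        padicValNat.eq_zero_of_not_dvd (by omega)
      -- Every vertex involved is the Gray code of 2u with certain bits flipped, so a finite Boolean
      -- check remains.
      rw [e1, e2, e3, testBit_gray_succ (2 * (u + 1)), hv,
        show 2 * (u + 1) = 2 * u + 1 + 1 by ring, testBit_gray_succ (2 * u + 1),
        testBit_gray_succ (2 * u), hv']
      generalize (gray (2 * u)).testBit i = a
      generalize decide (i = padicValNat 2 (2 * u + 1 + 1)) = c
      generalize decide (i = 0) = e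
      revert a c e; decide
  · have e1 : entryVertex (2 * u + 1) = gray (2 * u) := by
      unfold entryVertex; congr 1; omega
    have e2 : entryVertex (2 * u + 1 + 1) = gray (2 * u) := by
      unfold entryVertex; congr 1; omega
    have e3 : exitDirection (2 * u + 1) = padicValNat 2 (2 * u + 1 + 1) := by
      unfold exitDirection; congr 1; omega
    have hv : padicValNat 2 (2 * u + 1) = 0 :=
      padicValNat.eq_zero_of_not_dvd (by omega)
    -- Here the flip at bit 0 and the flip in the exit direction must not coincide; the identity
    -- would fail if they did.
    have hv2 : padicValNat 2 (2 * u + 1 + 1) ≠ 0 := by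
      rw [← dvd_iff_padicValNat_ne_zero (by omega)]; omega
    rw [e1, e2, e3, testBit_gray_succ (2 * u + 1), testBit_gray_succ (2 * u), hv]
    rcases Nat.eq_zero_or_pos i with rfl | hi
    · simp only [hv2.symm, decide_false, decide_true]
      generalize (gray (2 * u)).testBit 0 = a
      revert a; decide
    · simp only [hi.ne', decide_false]
      generalize (gray (2 * u)).testBit i = a
      generalize decide (i = padicValNat 2 (2 * u + 1 + 1)) = c
      revert a c; decide

/-- The last copy of the curve ends at the vertex `(0,…,0,1)`, bit by bit. -/
lemma last_exit_bit {d : ℕ} (hd : 0 < d) (i : ℕ) (hi : i < d) :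
    (gray (2 ^ d - 1)).testBit i = decide (i + 1 = d) ∧
      ((entryVertex (2 ^ d - 1)).testBit i ^^ decide (i = exitDirection (2 ^ d - 1) % d)) =
        decide (i + 1 = d) := by
  have hg : (gray (2 ^ d - 1)).testBit i = decide (i + 1 = d) := by
    rw [testBit_gray, Nat.testBit_two_pow_sub_one, Nat.testBit_two_pow_sub_one]
    by_cases h : i + 1 = d
    · simp [h]; omega
    · have : i + 1 < d := by omega
      simp [h, this]
      omega
  refine ⟨hg, ?_⟩
  obtain ⟨e, rfl⟩ : ∃ e, d = e + 1 := ⟨d - 1, by omega⟩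
  have hp := Nat.one_le_two_pow (n := e)
  -- The exponent is d itself, so the direction wraps around to 0, which is the bit in which the
  -- Gray codes of 2^d - 2 and 2^d - 1 differ.
  have e1 : exitDirection (2 ^ (e + 1) - 1) = e + 1 := by
    unfold exitDirection
    rw [show 2 * ((2 ^ (e + 1) - 1 + 1) / 2) = 2 ^ (e + 1) by rw [pow_succ]; omega]
    exact padicValNat.prime_pow _
  have e2 : entryVertex (2 ^ (e + 1) - 1) = gray (2 ^ (e + 1) - 2) := by
    unfold entryVertex; congr 1; rw [pow_succ]; omega
  have h3 := testBit_gray_succ (2 ^ (e + 1) - 2) i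
  have e4 : 2 ^ (e + 1) - 2 + 1 = 2 ^ (e + 1) - 1 := by rw [pow_succ]; omega
  rw [e4, padicValNat.eq_zero_of_not_dvd (by rw [pow_succ]; omega)] at h3
  rw [e1, e2, Nat.mod_self, ← h3, hg]

/-- Decoding runs from the top: bit i is the i-th Gray bit xor bit i + 1, and all bits from d on
vanish. -/
lemma gray_bits_injective {d v w : ℕ} (hv : v < 2 ^ d) (hw : w < 2 ^ d)
    (h : ∀ i < d, (gray v).testBit i = (gray w).testBit i) : v = w := by
  have key : ∀ k ≤ d, ∀ i, d - k ≤ i → v.testBit i = w.testBit i := by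
    intro k
    induction k with
    | zero =>
      intro _ i hi
      have := Nat.pow_le_pow_right (n := 2) (by norm_num) (show d ≤ i by simpa using hi)
      rw [Nat.testBit_lt_two_pow (hv.trans_le this), Nat.testBit_lt_two_pow (hw.trans_le this)]
    | succ k ih =>
      intro hk i hi
      rcases Nat.lt_or_ge i (d - k) with hlt | hge
      · have h1 := h i (by omega)
        rw [testBit_gray, testBit_gray, ih (by omega) (i + 1) (by omega)] at h1
        simpa using h1
      · exact ih (by omega) i hge
  exact Nat.eq_of_testBit_eq fun i => key d le_rfl i (by omega)

/-! ### The similarities -/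

section Similarity

variable {d : ℕ}

/-- A similarity of ratio `2^{-j}` along the coordinate axes that maps the unit cube to itself. -/
def IsDyadicSimilarity (j : ℕ) (T : EuclideanSpace ℝ (Fin d) → EuclideanSpace ℝ (Fin d)) : Prop :=
  ∃ (ρ : Equiv.Perm (Fin d)) (a ε : Fin d → ℝ), (∀ i, ε i = 1 ∨ ε i = -1) ∧
    (∀ y i, T y i = a i + (1 / 2) ^ j * (ε i * y (ρ i))) ∧ ∀ y ∈ unitCube d, T y ∈ unitCube d

lemma isDyadicSimilarity_id : IsDyadicSimilarity 0 (id : EuclideanSpace ℝ (Fin d) → _) :=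
  ⟨1, 0, 1, fun _ => Or.inl rfl, fun y i => by simp, fun _ h => h⟩

lemma IsDyadicSimilarity.comp {j k : ℕ}
    {T U : EuclideanSpace ℝ (Fin d) → EuclideanSpace ℝ (Fin d)}
    (hT : IsDyadicSimilarity j T) (hU : IsDyadicSimilarity k U) :
    IsDyadicSimilarity (j + k) (T ∘ U) := by
  obtain ⟨ρ, a, ε, hε, hTy, hTc⟩ := hT
  obtain ⟨ρ', a', ε', hε', hUy, hUc⟩ := hU
  refine ⟨ρ.trans ρ', fun i => a i + (1 / 2) ^ j * (ε i * a' (ρ i)),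
    fun i => ε i * ε' (ρ i), fun i => ?_, fun y i => ?_, fun y hy => hTc _ (hUc _ hy)⟩
  · rcases hε i with h | h <;> rcases hε' (ρ i) with h' | h' <;> simp [h, h']
  · simp only [Function.comp, hTy, hUy, Equiv.trans_apply]; ring

lemma IsDyadicSimilarity.norm_sub {j : ℕ}
    {T : EuclideanSpace ℝ (Fin d) → EuclideanSpace ℝ (Fin d)} (hT : IsDyadicSimilarity j T)
    (x y : EuclideanSpace ℝ (Fin d)) : ‖T x - T y‖ = (1 / 2) ^ j * ‖x - y‖ := by
  obtain ⟨ρ, a, ε, hε, hTy, -⟩ := hT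
  have h1 : ∀ i, ‖(T x - T y) i‖ ^ 2 = ((1 / 2) ^ j) ^ 2 * ‖(x - y) (ρ i)‖ ^ 2 := by
    intro i
    simp only [PiLp.sub_apply, hTy, Real.norm_eq_abs, sq_abs]
    rcases hε i with h | h <;> rw [h] <;> ring
  rw [EuclideanSpace.norm_eq, EuclideanSpace.norm_eq]
  simp_rw [h1]
  rw [← Finset.mul_sum, Equiv.sum_comp ρ fun i => ‖(x - y) i‖ ^ 2,
    Real.sqrt_mul (by positivity), Real.sqrt_sq (by positivity)]

lemma IsDyadicSimilarity.lipschitzWith {j : ℕ}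
    {T : EuclideanSpace ℝ (Fin d) → EuclideanSpace ℝ (Fin d)} (hT : IsDyadicSimilarity j T) :
    LipschitzWith ((1 / 2) ^ j) T :=
  LipschitzWith.of_dist_le_mul fun x y => by
    rw [dist_eq_norm, dist_eq_norm, hT.norm_sub]; simp

lemma isDyadicSimilarity_hilbertSimilarity [NeZero d] (w : ℕ) :
    IsDyadicSimilarity 1 (hilbertSimilarity (d := d) w) := by
  refine ⟨Equiv.subRight (Fin.ofNat d (exitDirection w + 1)),
    fun i => ((if (gray w).testBit i then 1 else 0) +
      (if (entryVertex w).testBit i then 1 else 0)) / 2,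
    fun i => if (entryVertex w).testBit i then -1 else 1, fun i => ?_, fun y i => ?_,
    fun y hy i => ?_⟩
  · by_cases h : (entryVertex w).testBit i <;> simp [h]
  · simp only [hilbertSimilarity, Equiv.subRight_apply]
    split_ifs <;> ring
  · have h := hy (i - Fin.ofNat d (exitDirection w + 1))
    simp only [Set.mem_Icc] at h
    simp only [hilbertSimilarity, Set.mem_Icc]
    split_ifs <;> constructor <;> linarith [h.1, h.2]

/-- The end `(0,…,0,1)` of the curve. -/
def lastVertex (d : ℕ) : EuclideanSpace ℝ (Fin d) :=
  WithLp.toLp 2 fun i => if (i : ℕ) + 1 = d then 1 else 0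

/-- The rotation by r + 1 turns the edge from the start to the end of the whole curve, which has
direction d - 1, into direction r modulo d. -/
lemma lastVertex_sub [NeZero d] (i : Fin d) (r : ℕ) :
    lastVertex d (i - Fin.ofNat d (r + 1)) = if (i : ℕ) = r % d then 1 else 0 := by
  have hd := NeZero.pos d
  have h1 : ((i - Fin.ofNat d (r + 1) : Fin d) : ℕ) + 1 = d ↔ (i : ℕ) = r % d := by
    rw [Fin.sub_def]
    simp only [Fin.ofNat]
    have hi := i.2
    rcases Nat.lt_or_ge (r % d + 1) d with h | h
    · have hr : (r + 1) % d = r % d + 1 := by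
        rw [← Nat.mod_add_mod, Nat.mod_eq_of_lt h]
      rw [hr]
      rcases Nat.lt_or_ge (d - (r % d + 1) + i) d with h2 | h2
      · rw [Nat.mod_eq_of_lt h2]; omega
      · rw [Nat.mod_eq_sub_mod h2, Nat.mod_eq_of_lt (by omega)]; omega
    · have hlt := Nat.mod_lt r hd
      have hr : (r + 1) % d = 0 := by
        rw [← Nat.mod_add_mod, show r % d + 1 = d by omega, Nat.mod_self]
      rw [hr, Nat.sub_zero, Nat.add_mod_left, Nat.mod_eq_of_lt hi]; omega
  simp only [lastVertex]
  exact if_congr h1 rfl rfl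

lemma hilbertSimilarity_lastVertex_apply [NeZero d] (w : ℕ) (i : Fin d) :
    hilbertSimilarity w (lastVertex d) i = (((gray w).testBit i).toNat +
      ((entryVertex w).testBit i ^^ decide ((i : ℕ) = exitDirection w % d)).toNat) / 2 := by
  simp only [hilbertSimilarity, lastVertex_sub]
  by_cases h : (i : ℕ) = exitDirection w % d <;>
    cases (gray w).testBit i <;> cases (entryVertex w).testBit i <;> simp [h]

lemma hilbertSimilarity_zero_apply [NeZero d] (w : ℕ) (i : Fin d) :
    hilbertSimilarity w (0 : EuclideanSpace ℝ (Fin d)) i = (((gray w).testBit i).toNat +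
      ((entryVertex w).testBit i).toNat) / 2 := by
  simp only [hilbertSimilarity]
  cases (gray w).testBit i <;> cases (entryVertex w).testBit i <;> simp

lemma hilbertSimilarity_lastVertex [NeZero d] {w : ℕ} (hw : w + 1 < 2 ^ d) :
    hilbertSimilarity w (lastVertex d) = hilbertSimilarity (w + 1) 0 := by
  ext i
  rw [hilbertSimilarity_lastVertex_apply, hilbertSimilarity_zero_apply,
    Nat.mod_eq_of_lt (exitDirection_lt hw)]
  rw [← Nat.cast_add, ← Nat.cast_add, exit_bit_add_eq]

lemma hilbertSimilarity_last [NeZero d] :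
    hilbertSimilarity (2 ^ d - 1) (lastVertex d) = lastVertex d := by
  ext i
  obtain ⟨h1, h2⟩ := last_exit_bit (NeZero.pos d) i i.2
  rw [hilbertSimilarity_lastVertex_apply, h1, h2, lastVertex]
  by_cases h : (i : ℕ) + 1 = d <;> simp [h]

lemma hilbertSimilarity_first [NeZero d] :
    hilbertSimilarity 0 (0 : EuclideanSpace ℝ (Fin d)) = 0 := by
  ext i
  rw [hilbertSimilarity_zero_apply]
  simp [gray, entryVertex]

/-! ### Self-similarity of the curve -/

lemma isClosed_unitCube : IsClosed (unitCube d) := by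
  simp only [unitCube, Set.ofPred_forall]
  exact isClosed_iInter fun i => isClosed_Icc.preimage (EuclideanSpace.proj i).continuous

lemma hilbertCurve_mem [NeZero d] {x : ℝ} (hx : x ∈ Set.Icc (0 : ℝ) 1) :
    hilbertCurve d x ∈ unitCube d :=
  isClosed_unitCube.mem_of_tendsto (tendsto_hilbertStage hx)
    (Eventually.of_forall fun k => hilbertStage_mem k x hx)

lemma hilbertCurve_eq [NeZero d] {x : ℝ} (hx : x ∈ Set.Icc (0 : ℝ) 1) :
    hilbertCurve d x = hilbertSimilarity (cellIndex d x)
      (hilbertCurve d ((2 : ℝ) ^ d * x - cellIndex d x)) := by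
  refine tendsto_nhds_unique
    ((tendsto_hilbertStage (d := d) hx).comp (tendsto_add_atTop_nat 1)) ?_
  exact ((isDyadicSimilarity_hilbertSimilarity _).lipschitzWith.continuous.tendsto _).comp
    (tendsto_hilbertStage (d := d) (rescale_mem hx))

/-- Identifies the endpoints of the curve: H(0) and H(1) are fixed by the first and the last
similarity, and a contraction has only one fixed point. -/
lemma IsDyadicSimilarity.eq_of_fixed {T : EuclideanSpace ℝ (Fin d) → EuclideanSpace ℝ (Fin d)}
    (hT : IsDyadicSimilarity 1 T) {x y : EuclideanSpace ℝ (Fin d)} (hx : T x = x) (hy : T y = y) :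
    x = y := by
  have h := hT.norm_sub x y
  rw [hx, hy] at h
  have : ‖x - y‖ = 0 := by linarith [norm_nonneg (x - y)]
  exact sub_eq_zero.1 (norm_eq_zero.1 this)

lemma hilbertCurve_zero [NeZero d] : hilbertCurve d 0 = 0 := by
  have h := hilbertCurve_eq (d := d) (x := 0) (by simp)
  have hc : cellIndex d 0 = 0 := by simp [cellIndex]
  rw [hc] at h
  simp only [mul_zero, Nat.cast_zero, sub_zero] at h
  exact (isDyadicSimilarity_hilbertSimilarity 0).eq_of_fixed h.symm hilbertSimilarity_first

lemma hilbertCurve_one_eq_lastVertex [NeZero d] : hilbertCurve d 1 = lastVertex d := by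
  have h := hilbertCurve_eq (d := d) (x := 1) (by simp)
  have hc : cellIndex d 1 = 2 ^ d - 1 := by
    have : ⌊(2 : ℝ) ^ d⌋₊ = 2 ^ d := by exact_mod_cast Nat.floor_natCast (R := ℝ) (2 ^ d)
    simp [cellIndex, this]
  have hs : (2 : ℝ) ^ d * 1 - (2 ^ d - 1 : ℕ) = 1 := by
    rw [Nat.cast_sub Nat.one_le_two_pow]; push_cast; ring
  rw [hc, hs] at h
  exact (isDyadicSimilarity_hilbertSimilarity _).eq_of_fixed h.symm hilbertSimilarity_last

/-- On each of the `2^d` closed intervals the curve is a copy of the whole curve. -/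
theorem hilbertCurve_add_div [NeZero d] {w : ℕ} (hw : w < 2 ^ d) {x : ℝ}
    (hx : x ∈ Set.Icc (0 : ℝ) 1) :
    hilbertCurve d (((w : ℝ) + x) / 2 ^ d) = hilbertSimilarity w (hilbertCurve d x) := by
  have hp : (0 : ℝ) < 2 ^ d := by positivity
  have hmem : ((w : ℝ) + x) / 2 ^ d ∈ Set.Icc (0 : ℝ) 1 := by
    exact_mod_cast add_div_mem_Icc hw hx
  have h := hilbertCurve_eq (d := d) hmem
  rw [mul_div_cancel₀ _ hp.ne'] at h
  have hcell : cellIndex d (((w : ℝ) + x) / 2 ^ d) = min ⌊(w : ℝ) + x⌋₊ (2 ^ d - 1) := by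
    rw [cellIndex, mul_div_cancel₀ _ hp.ne']
  rcases hx.2.lt_or_eq with hlt | rfl
  · have hf : ⌊(w : ℝ) + x⌋₊ = w := by
      rw [Nat.floor_eq_iff (by have := hx.1; positivity)]
      constructor <;> linarith [hx.1]
    rw [hf, min_eq_left (by omega)] at hcell
    rw [h, hcell, add_sub_cancel_left]
  -- At the right endpoint `cellIndex` already points to the next cell, unless w is the last one;
  -- the gluing of consecutive copies bridges the two.
  · have hf : ⌊(w : ℝ) + 1⌋₊ = w + 1 := by exact_mod_cast Nat.floor_natCast (R := ℝ) (w + 1)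
    rw [hf] at hcell
    rcases Nat.lt_or_ge (w + 1) (2 ^ d) with h2 | h2
    · rw [min_eq_left (by omega)] at hcell
      rw [h, hcell, hilbertCurve_one_eq_lastVertex, hilbertSimilarity_lastVertex h2]
      simp [hilbertCurve_zero]
    · have hw' : w = 2 ^ d - 1 := by omega
      rw [min_eq_right (by omega), ← hw'] at hcell
      rw [h, hcell, add_sub_cancel_left]

/-- On each of the `2^{dj}` closed intervals of level `j` the curve is a copy of the whole curve,
scaled by `2^{-j}`. -/
theorem exists_isDyadicSimilarity [NeZero d] (j : ℕ) : ∀ k : ℕ, k < 2 ^ (d * j) →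
    ∃ T : EuclideanSpace ℝ (Fin d) → EuclideanSpace ℝ (Fin d), IsDyadicSimilarity j T ∧
      ∀ x ∈ Set.Icc (0 : ℝ) 1,
        hilbertCurve d (((k : ℝ) + x) / 2 ^ (d * j)) = T (hilbertCurve d x) := by
  induction j with
  | zero =>
    intro k hk
    have hk0 : k = 0 := by rw [mul_zero, pow_zero] at hk; omega
    exact ⟨id, isDyadicSimilarity_id, fun x _ => by simp [hk0]⟩
  | succ j ih =>
    intro k hk
    have hp : (0 : ℕ) < 2 ^ (d * j) := by positivity
    obtain ⟨T, hT, hTx⟩ := ih (k % 2 ^ (d * j)) (Nat.mod_lt k hp)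
    have hw : k / 2 ^ (d * j) < 2 ^ d := by
      rw [Nat.div_lt_iff_lt_mul hp, ← pow_add]
      rwa [Nat.mul_succ, add_comm] at hk
    -- The quotient of k is the cell of the first level, hence the outermost similarity; the
    -- remainder is the position inside that cell.
    refine ⟨hilbertSimilarity (k / 2 ^ (d * j)) ∘ T, ?_, fun x hx => ?_⟩
    · rw [add_comm]; exact (isDyadicSimilarity_hilbertSimilarity _).comp hT
    · have hmem : ((k % 2 ^ (d * j) : ℕ) + x) / 2 ^ (d * j) ∈ Set.Icc (0 : ℝ) 1 := by
        exact_mod_cast add_div_mem_Icc (Nat.mod_lt k hp) hx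
      rw [Function.comp, ← hTx x hx, ← hilbertCurve_add_div hw hmem]
      congr 1
      have hk' : (k : ℝ) = 2 ^ (d * j) * (k / 2 ^ (d * j) : ℕ) + (k % 2 ^ (d * j) : ℕ) := by
        exact_mod_cast (Nat.div_add_mod k (2 ^ (d * j))).symm
      have : (2 : ℝ) ^ (d * (j + 1)) = 2 ^ d * 2 ^ (d * j) := by rw [← pow_add]; congr 1; ring
      rw [hk', this]; field_simp; ring

end Similarity

/-! ### Continuity of the curve -/

section Continuity

variable {d : ℕ}

lemma norm_sub_le_of_mem_unitCube {x y : EuclideanSpace ℝ (Fin d)} (hx : x ∈ unitCube d)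
    (hy : y ∈ unitCube d) : ‖x - y‖ ≤ √d := by
  rw [EuclideanSpace.norm_eq]
  refine Real.sqrt_le_sqrt ?_
  calc ∑ i, ‖(x - y) i‖ ^ 2 ≤ ∑ _i : Fin d, (1 : ℝ) := by
        refine Finset.sum_le_sum fun i _ => ?_
        have h1 := hx i
        have h2 := hy i
        rw [Real.norm_eq_abs, sq_abs, PiLp.sub_apply]
        nlinarith [h1.1, h1.2, h2.1, h2.2]
    _ = d := by simp

lemma isBounded_unitCube : Bornology.IsBounded (unitCube d) :=
  Metric.isBounded_iff.2 ⟨√d, fun x hx y hy => by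
    rw [dist_eq_norm]; exact norm_sub_le_of_mem_unitCube hx hy⟩

lemma isCompact_unitCube : IsCompact (unitCube d) :=
  Metric.isCompact_of_isClosed_isBounded isClosed_unitCube isBounded_unitCube

/-- Both points of the curve lie in the image of the unit cube, of diameter √d, under one similarity
of ratio 2^{-j}. -/
lemma norm_hilbertCurve_sub_le_of_mem_cell [NeZero d] {j k : ℕ} (hk : k < 2 ^ (d * j)) {x z : ℝ}
    (hx : (k : ℝ) ≤ 2 ^ (d * j) * x ∧ 2 ^ (d * j) * x ≤ k + 1)
    (hz : (k : ℝ) ≤ 2 ^ (d * j) * z ∧ 2 ^ (d * j) * z ≤ k + 1) :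
    ‖hilbertCurve d x - hilbertCurve d z‖ ≤ (1 / 2) ^ j * √d := by
  obtain ⟨T, hT, hTx⟩ := exists_isDyadicSimilarity (d := d) j k hk
  have key : ∀ y : ℝ, ((k : ℝ) ≤ 2 ^ (d * j) * y ∧ 2 ^ (d * j) * y ≤ k + 1) →
      ∃ y' ∈ Set.Icc (0 : ℝ) 1, hilbertCurve d y = T (hilbertCurve d y') := by
    intro y hy
    refine ⟨2 ^ (d * j) * y - k, ⟨by linarith [hy.1], by linarith [hy.2]⟩, ?_⟩
    rw [← hTx _ ⟨by linarith [hy.1], by linarith [hy.2]⟩]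
    congr 1; field_simp; ring
  obtain ⟨x', hx', hxx⟩ := key x hx
  obtain ⟨z', hz', hzz⟩ := key z hz
  rw [hxx, hzz, hT.norm_sub]
  exact mul_le_mul_of_nonneg_left
    (norm_sub_le_of_mem_unitCube (hilbertCurve_mem hx') (hilbertCurve_mem hz')) (by positivity)

/-- On an interval of length at most `2^{-dj}` the curve stays close to one of its points. -/
theorem exists_norm_hilbertCurve_sub_le [NeZero d] (j : ℕ) {a ℓ : ℝ} (ha : 0 ≤ a)
    (hℓ0 : 0 ≤ ℓ) (ha1 : a + ℓ ≤ 1) (hℓ : 2 ^ (d * j) * ℓ ≤ 1) :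
    ∃ z ∈ Set.Icc (0 : ℝ) 1, ∀ x ∈ Set.Icc a (a + ℓ),
      ‖hilbertCurve d x - hilbertCurve d z‖ ≤ (1 / 2) ^ j * √d := by
  have hp : (0 : ℝ) < 2 ^ (d * j) := by positivity
  have hN : 0 < 2 ^ (d * j) := by positivity
  obtain ⟨k, hk, hka, hka'⟩ : ∃ k : ℕ, k < 2 ^ (d * j) ∧ (k : ℝ) ≤ 2 ^ (d * j) * a ∧
      2 ^ (d * j) * a ≤ k + 1 := by
    rcases (show a ≤ 1 by linarith).lt_or_eq with h | rfl
    · refine ⟨⌊2 ^ (d * j) * a⌋₊, ?_, Nat.floor_le (by positivity), (Nat.lt_floor_add_one _).le⟩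
      rw [Nat.floor_lt (by positivity)]
      push_cast; nlinarith
    -- For a = 1 the floor would give a cell beyond the last one.
    · refine ⟨2 ^ (d * j) - 1, by omega, ?_, ?_⟩ <;>
        rw [Nat.cast_sub Nat.one_le_two_pow] <;> push_cast <;> linarith
  have hk1 : (k : ℝ) + 1 ≤ 2 ^ (d * j) := by exact_mod_cast hk
  have hz : 2 ^ (d * j) * (((k : ℝ) + 1) / 2 ^ (d * j)) = k + 1 := by field_simp
  -- The interval meets at most cell k and cell k + 1; their common endpoint is within one cell
  -- diameter of either.
  refine ⟨((k : ℝ) + 1) / 2 ^ (d * j), ⟨by positivity, by rwa [div_le_one hp]⟩, fun x hx => ?_⟩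
  have hx1 : 2 ^ (d * j) * a ≤ 2 ^ (d * j) * x := mul_le_mul_of_nonneg_left hx.1 hp.le
  have hx2 : 2 ^ (d * j) * x ≤ 2 ^ (d * j) * (a + ℓ) := mul_le_mul_of_nonneg_left hx.2 hp.le
  rcases le_or_gt (2 ^ (d * j) * x) (k + 1) with h | h
  · exact norm_hilbertCurve_sub_le_of_mem_cell hk ⟨by linarith, h⟩
      ⟨by rw [hz]; linarith, by rw [hz]⟩
  · have hx3 : 2 ^ (d * j) * x ≤ 2 ^ (d * j) := by nlinarith [hx.2]
    have hk2 : k + 1 < 2 ^ (d * j) := by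
      have : ((k + 1 : ℕ) : ℝ) < (2 ^ (d * j) : ℕ) := by push_cast; linarith
      exact_mod_cast this
    refine norm_hilbertCurve_sub_le_of_mem_cell hk2 ?_ ?_ <;> push_cast
    · constructor <;> linarith
    · rw [hz]; constructor <;> linarith

theorem continuousOn_hilbertCurve [NeZero d] :
    ContinuousOn (hilbertCurve d) (Set.Icc (0 : ℝ) 1) := by
  rw [Metric.continuousOn_iff]
  intro x hx ε hε
  have hlim : Tendsto (fun j : ℕ => 2 * ((1 / 2 : ℝ) ^ j * √d)) atTop (𝓝 0) := by
    simpa using ((tendsto_pow_atTop_nhds_zero_of_lt_one (r := (1 / 2 : ℝ)) (by norm_num)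
      (by norm_num)).mul_const (√d)).const_mul 2
  obtain ⟨j, hj⟩ := (hlim.eventually_lt_const hε).exists
  have hp : (0 : ℝ) < 2 ^ (d * j) := by positivity
  refine ⟨1 / 2 ^ (d * j), by positivity, fun y hy hxy => ?_⟩
  rw [Real.dist_eq] at hxy
  obtain ⟨z, -, hz⟩ := exists_norm_hilbertCurve_sub_le (d := d) j (a := min x y) (ℓ := |y - x|)
    (le_min hx.1 hy.1) (abs_nonneg _)
    (by rcases le_total x y with h | h
        · rw [min_eq_left h, abs_of_nonneg (by linarith)]; linarith [hy.2]
        · rw [min_eq_right h, abs_of_nonpos (by linarith)]; linarith [hx.2])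
    (by rw [lt_div_iff₀ hp] at hxy; linarith)
  have h1 := hz x (by
    rcases le_total x y with h | h
    · rw [min_eq_left h, abs_of_nonneg (by linarith)]; constructor <;> linarith
    · rw [min_eq_right h, abs_of_nonpos (by linarith)]; constructor <;> linarith)
  have h2 := hz y (by
    rcases le_total x y with h | h
    · rw [min_eq_left h, abs_of_nonneg (by linarith)]; constructor <;> linarith
    · rw [min_eq_right h, abs_of_nonpos (by linarith)]; constructor <;> linarith)
  rw [dist_eq_norm]
  have h3 := norm_sub_le_norm_sub_add_norm_sub (hilbertCurve d y) (hilbertCurve d z)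
    (hilbertCurve d x)
  rw [norm_sub_rev (hilbertCurve d z)] at h3
  linarith

/-- The curve, extended to the real line by constants. -/
def extendedCurve (d : ℕ) [NeZero d] (x : ℝ) : EuclideanSpace ℝ (Fin d) :=
  hilbertCurve d (max 0 (min x 1))

lemma clamp_mem (x : ℝ) : max 0 (min x 1) ∈ Set.Icc (0 : ℝ) 1 :=
  ⟨le_max_left _ _, max_le zero_le_one (min_le_right _ _)⟩

lemma extendedCurve_eq [NeZero d] {x : ℝ} (hx : x ∈ Set.Icc (0 : ℝ) 1) :
    extendedCurve d x = hilbertCurve d x := by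
  rw [extendedCurve, min_eq_left hx.2, max_eq_right hx.1]

lemma extendedCurve_mem [NeZero d] (x : ℝ) : extendedCurve d x ∈ unitCube d :=
  hilbertCurve_mem (clamp_mem x)

lemma continuous_extendedCurve [NeZero d] : Continuous (extendedCurve d) :=
  continuousOn_hilbertCurve.comp_continuous (by fun_prop) clamp_mem

end Continuity

/-! ### The curve preserves measure -/

section MeasurePreserving

variable {d : ℕ}

lemma unif_preimage_one_sub {s : Set ℝ} (hs : MeasurableSet s) :
    unif ((fun t => 1 - t) ⁻¹' s) = unif s := by
  have h := (Measure.measurePreserving_sub_left (volume : Measure ℝ) 1).restrict_preimage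
    (measurableSet_Icc (a := (0 : ℝ)) (b := 1))
  have hI : (fun t : ℝ => 1 - t) ⁻¹' Set.Icc 0 1 = Set.Icc 0 1 := by
    ext t; simp
  rw [hI] at h
  exact h.measure_preimage hs.nullMeasurableSet

lemma unif_preimage_halves {s : Set ℝ} (hs : MeasurableSet s) :
    ∑ β : Bool, unif ((fun t : ℝ => ((β.toNat : ℝ) + t) / 2) ⁻¹' s) = 2 * unif s := by
  have h := integral_unif_eq_avg (N := 2) (by norm_num) (g := s.indicator 1)
    ((integrable_indicator_iff hs).2 (integrable_const (1 : ℝ)).integrableOn)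
  have hm : ∀ k : ℕ, MeasurableSet ((fun t : ℝ => ((k : ℝ) + t) / 2) ⁻¹' s) := fun k =>
    (by fun_prop : Measurable fun t : ℝ => ((k : ℝ) + t) / 2) hs
  have hc : ∀ k : ℕ, (fun x : ℝ => s.indicator (1 : ℝ → ℝ) (((k : ℝ) + x) / (2 : ℕ))) =
      ((fun t : ℝ => ((k : ℝ) + t) / 2) ⁻¹' s).indicator 1 := by
    intro k; ext x; simp [Set.indicator, Set.mem_preimage]; rfl
  simp_rw [hc] at h
  rw [Finset.sum_range_succ, Finset.sum_range_one, integral_indicator_one hs,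
    integral_indicator_one (hm _), integral_indicator_one (hm _)] at h
  rw [Fintype.sum_bool, ← ENNReal.toReal_eq_toReal_iff' (by finiteness) (by finiteness),
    ENNReal.toReal_add (by finiteness) (by finiteness), ENNReal.toReal_mul]
  simp only [Measure.real, Nat.cast_zero, Nat.cast_one] at h
  simp only [Bool.toNat_true, Bool.toNat_false, Nat.cast_zero, Nat.cast_one, ENNReal.toReal_ofNat]
  push_cast at h
  linarith

/-- The uniform distribution on the unit cube, with independent uniform coordinates. -/
def unifCube (d : ℕ) : Measure (EuclideanSpace ℝ (Fin d)) :=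
  (Measure.pi fun _ : Fin d => unif).map (WithLp.toLp 2)

lemma measurable_toLp_fin : Measurable (WithLp.toLp 2 : (Fin d → ℝ) → EuclideanSpace ℝ (Fin d)) :=
  (PiLp.continuous_toLp 2 fun _ : Fin d => ℝ).measurable

instance : IsProbabilityMeasure (unifCube d) :=
  Measure.isProbabilityMeasure_map measurable_toLp_fin.aemeasurable

lemma unifCube_eq : unifCube d = volume.restrict (unitCube d) := by
  have hm : MeasurableSet (unitCube d) := isClosed_unitCube.measurableSet
  have h := (PiLp.volume_preserving_toLp (Fin d)).restrict_preimage hm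
  have hpre : (WithLp.toLp 2 : (Fin d → ℝ) → EuclideanSpace ℝ (Fin d)) ⁻¹' unitCube d =
      Set.univ.pi fun _ => Set.Icc 0 1 := by
    ext x; simp only [unitCube, Set.mem_preimage, Set.mem_univ_pi]; rfl
  rw [hpre, volume_pi, Measure.restrict_pi_pi] at h
  exact h.map_eq

lemma ae_unifCube_mem : ∀ᵐ x ∂unifCube d, x ∈ unitCube d := by
  rw [unifCube_eq]; exact ae_restrict_mem isClosed_unitCube.measurableSet

/-- A similarity of the construction, on one coordinate of the image. -/
def coordinateMap (w i : ℕ) (t : ℝ) : ℝ :=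
  (((gray w).testBit i).toNat + if (entryVertex w).testBit i then 1 - t else t) / 2

lemma measurable_coordinateMap (w i : ℕ) : Measurable (coordinateMap w i) := by
  unfold coordinateMap
  split_ifs <;> fun_prop

lemma hilbertSimilarity_toLp_apply [NeZero d] (w : ℕ) (y : Fin d → ℝ) (i : Fin d) :
    hilbertSimilarity w (WithLp.toLp 2 y) i =
      coordinateMap w i (y (i - Fin.ofNat d (exitDirection w + 1))) := by
  simp only [hilbertSimilarity, coordinateMap]
  cases (gray w).testBit i <;> simp

/-- Reflections preserve the uniform law, so the entry vertex has no effect on measures; only the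
Gray bit matters. -/
lemma unif_preimage_coordinateMap (w i : ℕ) {s : Set ℝ} (hs : MeasurableSet s) :
    unif (coordinateMap w i ⁻¹' s) =
      unif ((fun t : ℝ => ((((gray w).testBit i).toNat : ℝ) + t) / 2) ⁻¹' s) := by
  have hm : MeasurableSet
      ((fun t : ℝ => ((((gray w).testBit i).toNat : ℝ) + t) / 2) ⁻¹' s) :=
    (by fun_prop : Measurable fun t : ℝ => ((((gray w).testBit i).toNat : ℝ) + t) / 2) hs
  unfold coordinateMap
  by_cases h : (entryVertex w).testBit i
  · simp only [h, if_true]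
    rw [← unif_preimage_one_sub hm]; rfl
  · simp only [h]; rfl

lemma pi_preimage_hilbertSimilarity [NeZero d] (w : ℕ) {s : Fin d → Set ℝ}
    (hs : ∀ i, MeasurableSet (s i)) :
    (Measure.pi fun _ : Fin d => unif)
        ((fun y => WithLp.ofLp (hilbertSimilarity w (WithLp.toLp 2 y))) ⁻¹' Set.univ.pi s) =
      ∏ i : Fin d,
        unif ((fun t : ℝ => ((((gray w).testBit i).toNat : ℝ) + t) / 2) ⁻¹' s i) := by
  set r := Fin.ofNat d (exitDirection w + 1) with hr
  have hset : (fun y : Fin d → ℝ => WithLp.ofLp (hilbertSimilarity w (WithLp.toLp 2 y))) ⁻¹'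
      Set.univ.pi s = Set.univ.pi fun k : Fin d =>
        coordinateMap w (k + r : Fin d) ⁻¹' s (k + r) := by
    ext y
    simp only [Set.mem_preimage, Set.mem_univ_pi, hilbertSimilarity_toLp_apply, ← hr]
    refine ⟨fun h k => by simpa using h (k + r), fun h i => by simpa using h (i - r)⟩
  rw [hset, Measure.pi_pi, ← Equiv.prod_comp (Equiv.addRight r) fun i : Fin d =>
    unif ((fun t : ℝ => ((((gray w).testBit i).toNat : ℝ) + t) / 2) ⁻¹' s i)]
  refine Finset.prod_congr rfl fun k _ => ?_
  exact unif_preimage_coordinateMap _ _ (hs _)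

lemma bijective_gray_bits :
    Function.Bijective fun (w : Fin (2 ^ d)) (i : Fin d) => (gray w).testBit i := by
  rw [Fintype.bijective_iff_injective_and_card]
  refine ⟨fun v w h => Fin.ext ?_, by simp⟩
  exact gray_bits_injective v.2 w.2 fun i hi => congrFun h ⟨i, hi⟩

/-- On a box each image measure is a product over coordinates that depends only on the Gray bits.
The Gray code runs once through all bit vectors, so the sum over w factors into a product over the
coordinates of the sums over two halves. -/
lemma pi_unif_eq_avg [NeZero d] : (Measure.pi fun _ : Fin d => unif) =
    ∑ w ∈ Finset.range (2 ^ d), ((2 : ℝ≥0∞) ^ d)⁻¹ • (Measure.pi fun _ : Fin d => unif).map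
      (fun y => WithLp.ofLp (hilbertSimilarity w (WithLp.toLp 2 y))) := by
  refine Measure.pi_eq fun s hs => ?_
  have hm : ∀ w, Measurable fun y : Fin d → ℝ =>
      WithLp.ofLp (hilbertSimilarity w (WithLp.toLp 2 y)) := fun w =>
    measurable_pi_lambda _ fun i => by
      simp only [hilbertSimilarity_toLp_apply]
      exact (measurable_coordinateMap w i).comp (measurable_pi_apply _)
  rw [Measure.finsetSum_apply]
  simp only [Measure.smul_apply, smul_eq_mul]
  rw [← Finset.mul_sum]
  have h1 : ∀ w ∈ Finset.range (2 ^ d), (Measure.pi fun _ : Fin d => unif).map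
      (fun y => WithLp.ofLp (hilbertSimilarity w (WithLp.toLp 2 y))) (Set.univ.pi s) =
      ∏ i : Fin d,
        unif ((fun t : ℝ => ((((gray w).testBit i).toNat : ℝ) + t) / 2) ⁻¹' s i) := fun w _ => by
    rw [Measure.map_apply (hm w) (MeasurableSet.univ_pi hs), pi_preimage_hilbertSimilarity w hs]
  rw [Finset.sum_congr rfl h1, Finset.sum_range,
    bijective_gray_bits.sum_comp fun β : Fin d → Bool =>
      ∏ i : Fin d, unif ((fun t : ℝ => (((β i).toNat : ℝ) + t) / 2) ⁻¹' s i),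
    ← Fintype.prod_sum fun (i : Fin d) (β : Bool) =>
      unif ((fun t : ℝ => ((β.toNat : ℝ) + t) / 2) ⁻¹' s i)]
  simp_rw [unif_preimage_halves (hs _)]
  rw [Finset.prod_mul_distrib, ← mul_assoc]
  simp [ENNReal.inv_mul_cancel]

lemma integral_unifCube_eq_avg [NeZero d] {f : EuclideanSpace ℝ (Fin d) → ℝ} (hf : Continuous f) :
    ∫ x, f x ∂unifCube d =
      ∑ w ∈ Finset.range (2 ^ d), (1 / (2 : ℝ) ^ d) *
        ∫ x, f (hilbertSimilarity w x) ∂unifCube d := by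
  have hT : ∀ w, Continuous (hilbertSimilarity (d := d) w) := fun w =>
    (isDyadicSimilarity_hilbertSimilarity w).lipschitzWith.continuous
  have hofLp := PiLp.continuous_ofLp 2 fun _ : Fin d => ℝ
  have htoLp := PiLp.continuous_toLp 2 fun _ : Fin d => ℝ
  have hm : ∀ w, Measurable fun y : Fin d → ℝ =>
      WithLp.ofLp (hilbertSimilarity w (WithLp.toLp 2 y)) := fun w =>
    (hofLp.comp ((hT w).comp htoLp)).measurable
  have hc : Continuous fun y : Fin d → ℝ => f (WithLp.toLp 2 y) := hf.comp htoLp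
  unfold unifCube
  rw [integral_map measurable_toLp_fin.aemeasurable hf.aestronglyMeasurable]
  conv_lhs => rw [pi_unif_eq_avg]
  rw [integral_finsetSum_measure]
  · refine Finset.sum_congr rfl fun w _ => ?_
    rw [integral_smul_measure, integral_map (hm w).aemeasurable hc.aestronglyMeasurable,
      integral_map measurable_toLp_fin.aemeasurable (Continuous.aestronglyMeasurable (by fun_prop))]
    simp
  · intro w _
    refine Integrable.smul_measure ?_ (by simp)
    rw [integrable_map_measure hc.aestronglyMeasurable (hm w).aemeasurable]
    have hmem : ∀ᵐ y ∂(Measure.pi fun _ : Fin d => unif), WithLp.toLp 2 y ∈ unitCube d :=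
      ae_of_ae_map measurable_toLp_fin.aemeasurable ae_unifCube_mem
    obtain ⟨C, hC⟩ := isCompact_unitCube.exists_bound_of_continuousOn (f := f) hf.continuousOn
    refine Integrable.of_bound (hc.measurable.comp (hm w)).aestronglyMeasurable C
      (hmem.mono fun y hy => ?_)
    obtain ⟨_, _, _, _, _, h⟩ := isDyadicSimilarity_hilbertSimilarity (d := d) w
    exact hC _ (h _ hy)

/-- Hilbert's curve carries Lebesgue measure on the unit interval to Lebesgue measure on the unit
cube. -/
theorem map_extendedCurve [NeZero d] : unif.map (extendedCurve d) = unifCube d := by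
  have hm := (continuous_extendedCurve (d := d)).measurable
  have : IsProbabilityMeasure (unif.map (extendedCurve d)) :=
    Measure.isProbabilityMeasure_map hm.aemeasurable
  refine eq_of_selfSimilar isBounded_unitCube ?_ ae_unifCube_mem (Finset.range (2 ^ d))
    (p := 1 / (2 : ℝ) ^ d) (by positivity) (by simp) (q := (1 / 2) ^ 1) ?_
    (T := fun w => hilbertSimilarity w)
    (fun w _ => (isDyadicSimilarity_hilbertSimilarity w).lipschitzWith) ?_
    fun f ⟨L, hf⟩ => integral_unifCube_eq_avg hf.continuous
  · exact (ae_map_iff hm.aemeasurable isClosed_unitCube.measurableSet).2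
      (ae_of_all _ extendedCurve_mem)
  · rw [pow_one]; exact half_lt_self one_pos
  · rintro f ⟨L, hf⟩
    have hcont : Continuous fun x => f (extendedCurve d x) :=
      hf.continuous.comp continuous_extendedCurve
    rw [integral_map hm.aemeasurable hf.continuous.aestronglyMeasurable,
      integral_unif_eq_avg (N := 2 ^ d) (by positivity)
        (integrable_unif_iff.2 (hcont.intervalIntegrable 0 1))]
    refine Finset.sum_congr rfl fun w hw => ?_
    have hw' := Finset.mem_range.1 hw
    have hT := (isDyadicSimilarity_hilbertSimilarity (d := d) w).lipschitzWith.continuous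
    have hfc := hf.continuous
    rw [integral_map hm.aemeasurable (Continuous.aestronglyMeasurable (by fun_prop))]
    push_cast
    congr 1
    refine integral_congr_ae (ae_unif_mem.mono fun x hx => ?_)
    simp only
    have hmem := add_div_mem_Icc hw' hx
    push_cast at hmem
    rw [extendedCurve_eq hmem, hilbertCurve_add_div hw' hx, extendedCurve_eq hx]

end MeasurePreserving

/-! ### Scrambled points as a stratified sample -/

section Scrambling

variable {b : ℕ} [NeZero b]

/-- The discrete σ-algebra, in agreement with the one in `IsNestedUniformScrambling.indep`. -/
instance : MeasurableSpace (Equiv.Perm (Fin b)) := ⊤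

instance : DiscreteMeasurableSpace (Equiv.Perm (Fin b)) := ⟨fun _ => trivial⟩

lemma scrambledPoint_eq_ofDigits (σ : List (Fin b) → Equiv.Perm (Fin b)) (i : ℕ) :
    scrambledPoint σ i = Real.ofDigits fun j =>
      σ (List.ofFn fun k : Fin j => vdcDigit b i k) (vdcDigit b i j) := by
  simp only [scrambledPoint, Real.ofDigits, Real.ofDigitsTerm, div_eq_mul_inv]

/-- The scrambling of the strings of `m` digits. -/
def scrambleString (m : ℕ) (σ : List (Fin b) → Equiv.Perm (Fin b)) (a : Fin m → Fin b) :
    Fin m → Fin b :=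
  fun j => σ (List.ofFn fun k : Fin j => a ⟨k, k.2.trans j.2⟩) (a j)

/-- The node `j` levels below the string `a` whose further digits are zero. -/
def zeroExtension {m : ℕ} (a : Fin m → Fin b) (j : ℕ) : List (Fin b) :=
  List.ofFn a ++ List.replicate j 0

/-- The scrambled digits that follow the string `a`, as a number in `[0,1]`. -/
def scrambledTail {m : ℕ} (σ : List (Fin b) → Equiv.Perm (Fin b)) (a : Fin m → Fin b) : ℝ :=
  Real.ofDigits fun j => σ (zeroExtension a j) 0

/-- Strings of `m` digits correspond to the `b^m` intervals of length `b^{-m}`. -/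
def cellEquiv (b m : ℕ) : (Fin m → Fin b) ≃ Fin (b ^ m) :=
  -- `finFunctionFinEquiv` treats digit 0 as the least significant; the reversal makes the first
  -- digit the most significant.
  (Equiv.arrowCongr Fin.revPerm (Equiv.refl _)).trans finFunctionFinEquiv

lemma cellEquiv_val {m : ℕ} (c : Fin m → Fin b) :
    ((cellEquiv b m c : ℕ) : ℝ) / (b : ℝ) ^ m =
      ∑ j : Fin m, (c j : ℝ) * ((b : ℝ) ^ (j + 1 : ℕ))⁻¹ := by
  have hb : (b : ℝ) ≠ 0 := by exact_mod_cast NeZero.ne b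
  have h1 : (cellEquiv b m c : ℕ) = ∑ j : Fin m, (c j : ℕ) * b ^ (m - (j + 1)) := by
    simp only [cellEquiv, Equiv.trans_apply, finFunctionFinEquiv_apply]
    rw [← Equiv.sum_comp Fin.revPerm]
    refine Finset.sum_congr rfl fun j _ => ?_
    simp [Equiv.arrowCongr, Fin.val_rev]
  rw [h1, Nat.cast_sum, Finset.sum_div]
  refine Finset.sum_congr rfl fun j _ => ?_
  have h2 : (b : ℝ) ^ m = b ^ (m - (j + 1 : ℕ)) * b ^ (j + 1 : ℕ) := by
    rw [← pow_add]; congr 1; omega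
  push_cast
  rw [h2]; field_simp

lemma vdcDigit_eq_zero {m i j : ℕ} (hi : i < b ^ m) (hj : m ≤ j) : vdcDigit b i j = 0 := by
  have : i / b ^ j = 0 := Nat.div_eq_of_lt
    (hi.trans_le (Nat.pow_le_pow_right (NeZero.pos b) hj))
  rw [vdcDigit, this]; rfl

lemma ofFn_vdcDigit {m i : ℕ} (hi : i < b ^ m) (j : ℕ) :
    (List.ofFn fun k : Fin (j + m) => vdcDigit b i k) =
      zeroExtension (fun k : Fin m => vdcDigit b i k) j := by
  rw [zeroExtension, ← List.ofFn_const, add_comm, ← List.ofFn_fin_append]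
  congr 1
  ext k
  refine Fin.addCases (fun k => ?_) (fun k => ?_) k
  · simp
  · simp [vdcDigit_eq_zero hi]

/-- Below b^m the unscrambled digits from place m on are all 0, so the later scrambled digits come
from the nodes of `zeroExtension`. -/
lemma scrambledPoint_eq {m i : ℕ} (hi : i < b ^ m) (σ : List (Fin b) → Equiv.Perm (Fin b)) :
    scrambledPoint σ i =
      ((cellEquiv b m (scrambleString m σ fun k : Fin m => vdcDigit b i k) : ℕ) +
        scrambledTail σ fun k : Fin m => vdcDigit b i k) / (b : ℝ) ^ m := by
  rw [add_div, cellEquiv_val, scrambledPoint_eq_ofDigits, Real.ofDigits_eq_sum_add_ofDigits _ m,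
    Finset.sum_range]
  congr 1
  rw [scrambledTail, div_eq_inv_mul]
  congr 2
  ext j
  rw [ofFn_vdcDigit hi, vdcDigit_eq_zero hi (Nat.le_add_left m j)]

-- Digits are recovered from left to right: once the earlier ones agree, the same permutation acts
-- on the next.
omit [NeZero b] in
lemma injective_scrambleString (m : ℕ) (σ : List (Fin b) → Equiv.Perm (Fin b)) :
    Function.Injective (scrambleString m σ) := by
  intro a a' h
  have key : ∀ j : ℕ, ∀ hj : j < m, a ⟨j, hj⟩ = a' ⟨j, hj⟩ := by
    intro j
    induction j using Nat.strong_induction_on with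
    | _ j ih =>
      intro hj
      have h1 := congrFun h ⟨j, hj⟩
      simp only [scrambleString] at h1
      have h2 : (fun k : Fin j => a ⟨k, k.2.trans hj⟩) = fun k : Fin j => a' ⟨k, k.2.trans hj⟩ :=
        funext fun k => ih k k.2 _
      rw [h2] at h1
      exact (σ _).injective h1
  exact funext fun j => key j j.2

lemma bijective_scrambleString (m : ℕ) (σ : List (Fin b) → Equiv.Perm (Fin b)) :
    Function.Bijective (scrambleString m σ) :=
  Finite.injective_iff_bijective.1 (injective_scrambleString m σ)

/-- The family `r`, indexed by the intervals to which the permutation `s` of the strings moves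
them. -/
def unscramble {m : ℕ} (s : (Fin m → Fin b) → Fin m → Fin b) (r : (Fin m → Fin b) → ℝ)
    (k : Fin (b ^ m)) : ℝ :=
  r (Function.invFun s ((cellEquiv b m).symm k))

lemma sum_scrambledPoint (m : ℕ) (σ : List (Fin b) → Equiv.Perm (Fin b)) (F : ℝ → ℝ) :
    ∑ i ∈ Finset.range (b ^ m), F (scrambledPoint σ i) =
      ∑ k : Fin (b ^ m),
        F (((k : ℕ) + unscramble (scrambleString m σ) (scrambledTail σ) k) / (b : ℝ) ^ m) := by
  -- No reversal here: the van der Corput digits list the expansion of i from its lowest digit.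
  have hdig : ∀ i : Fin (b ^ m), (fun k : Fin m => vdcDigit b i k) = finFunctionFinEquiv.symm i := by
    intro i; ext k
    simp [vdcDigit, finFunctionFinEquiv_symm_apply_val]
  rw [Finset.sum_range]
  simp_rw [fun i : Fin (b ^ m) => scrambledPoint_eq i.2 σ, hdig]
  rw [Equiv.sum_comp finFunctionFinEquiv.symm fun a : Fin m → Fin b =>
    F (((cellEquiv b m (scrambleString m σ a) : ℕ) + scrambledTail σ a) / (b : ℝ) ^ m),
    ← Equiv.sum_comp (((Equiv.ofBijective _ (bijective_scrambleString m σ)).trans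
      (cellEquiv b m)))]
  refine Finset.sum_congr rfl fun a _ => ?_
  have h := Function.leftInverse_invFun (injective_scrambleString m σ) a
  simp only [unscramble, Equiv.trans_apply, Equiv.ofBijective_apply, Equiv.symm_apply_apply, h]

variable {Ω : Type*} [MeasurableSpace Ω] {P : Measure Ω}
  {π : List (Fin b) → Ω → Equiv.Perm (Fin b)}

omit [NeZero b] in
lemma IsNestedUniformScrambling.measurable (hπ : IsNestedUniformScrambling P π)
    (s : List (Fin b)) : Measurable (π s) :=
  measurable_to_countable' fun τ => hπ.measurableSet s τ

-- Composition with the transposition of two values exchanges their fibres, so all b fibres have the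
-- same size.
omit [NeZero b] in
lemma card_perm_apply_eq (a c : Fin b) :
    b * (Finset.univ.filter fun τ : Equiv.Perm (Fin b) => τ a = c).card = b.factorial := by
  have h1 : ∀ c' : Fin b, (Finset.univ.filter fun τ : Equiv.Perm (Fin b) => τ a = c').card =
      (Finset.univ.filter fun τ : Equiv.Perm (Fin b) => τ a = c).card := by
    intro c'
    refine Finset.card_bij' (fun τ _ => Equiv.swap c c' * τ) (fun τ _ => Equiv.swap c c' * τ)
      ?_ ?_ ?_ ?_
    · intro τ hτ; simp only [Finset.mem_filter, Finset.mem_univ, true_and] at hτ ⊢; simp [hτ]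
    · intro τ hτ; simp only [Finset.mem_filter, Finset.mem_univ, true_and] at hτ ⊢; simp [hτ]
    · intro τ _; simp [← mul_assoc]
    · intro τ _; simp [← mul_assoc]
  have h2 := Finset.card_eq_sum_card_fiberwise (s := (Finset.univ : Finset (Equiv.Perm (Fin b))))
    (t := Finset.univ) (f := fun τ => τ a) (by simp)
  rw [Finset.sum_congr rfl fun c' _ => h1 c'] at h2
  simpa [Fintype.card_perm] using h2.symm

lemma IsNestedUniformScrambling.map_apply (hπ : IsNestedUniformScrambling P π)
    (s : List (Fin b)) (a : Fin b) : P.map (fun ω => π s ω a) = unifDigit b := by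
  have hm : Measurable fun ω => π s ω a :=
    (measurable_of_finite fun τ : Equiv.Perm (Fin b) => τ a).comp (hπ.measurable s)
  refine Measure.ext_of_singleton fun c => ?_
  rw [Measure.map_apply hm (measurableSet_singleton c), unifDigit_singleton]
  have h1 : (fun ω => π s ω a) ⁻¹' {c} =
      ⋃ τ ∈ Finset.univ.filter fun τ : Equiv.Perm (Fin b) => τ a = c, {ω | π s ω = τ} := by
    ext ω; simp
  rw [h1, measure_biUnion_finset _ fun τ _ => hπ.measurableSet s τ]
  · simp only [hπ.uniform, Finset.sum_const, nsmul_eq_mul]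
    rw [← card_perm_apply_eq a c]
    have hb : (b : ℝ≥0∞) ≠ 0 := by exact_mod_cast NeZero.ne b
    have hc : ((Finset.univ.filter fun τ : Equiv.Perm (Fin b) => τ a = c).card : ℝ≥0∞) ≠ 0 := by
      intro h
      have h3 := card_perm_apply_eq a c
      rw [Nat.cast_eq_zero.1 h, mul_zero] at h3
      exact b.factorial_ne_zero h3.symm
    push_cast
    rw [ENNReal.mul_inv (Or.inl hb) (Or.inr hc), mul_left_comm,
      ENNReal.mul_inv_cancel hc (by simp), mul_one]
  · intro τ _ τ' _ hne
    exact Set.disjoint_left.2 fun ω h h' => hne (h.symm.trans h')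

lemma zeroExtension_injective (m : ℕ) :
    Function.Injective fun p : (Fin m → Fin b) × ℕ => zeroExtension p.1 p.2 := by
  rintro ⟨a, j⟩ ⟨a', j'⟩ h
  simp only [zeroExtension] at h
  have h1 := List.append_inj h (by simp)
  have h2 : a = a' := List.ofFn_injective h1.1
  have h3 : j = j' := by simpa using congrArg List.length h1.2
  rw [h2, h3]

/-- The tails below the strings of `m` digits are independent and uniformly distributed. -/
lemma IsNestedUniformScrambling.map_scrambledTail [IsProbabilityMeasure P] (hb : 2 ≤ b)
    (hπ : IsNestedUniformScrambling P π) (m : ℕ) :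
    P.map (fun ω (a : Fin m → Fin b) => scrambledTail (fun s => π s ω) a) =
      Measure.pi fun _ => unif := by
  have hm : ∀ p : (Fin m → Fin b) × ℕ, Measurable fun ω => π (zeroExtension p.1 p.2) ω 0 :=
    fun p => (measurable_of_finite fun τ : Equiv.Perm (Fin b) => τ 0).comp (hπ.measurable _)
  -- Different pairs of a string and a depth use different nodes, so all tail digits are jointly
  -- independent.
  have hind : iIndepFun (fun (p : (Fin m → Fin b) × ℕ) ω => π (zeroExtension p.1 p.2) ω 0) P :=
    (hπ.indep.precomp (zeroExtension_injective m)).comp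
      (fun _ (τ : Equiv.Perm (Fin b)) => τ 0) fun _ => measurable_of_finite _
  have h1 := hind.map_fun_eq_infinitePi_map hm
  simp_rw [hπ.map_apply] at h1
  have h2 := congrArg (Measure.map (MeasurableEquiv.curry (Fin m → Fin b) ℕ (Fin b))) h1
  rw [Measure.infinitePi_map_curry (fun _ _ => unifDigit b), Measure.map_map (by fun_prop)
    (measurable_pi_lambda _ hm)] at h2
  have h3 := congrArg (Measure.map fun (x : (Fin m → Fin b) → ℕ → Fin b) a =>
    Real.ofDigits (x a)) h2
  have hod : Measurable fun (x : (Fin m → Fin b) → ℕ → Fin b) a => Real.ofDigits (x a) :=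
    measurable_pi_lambda _ fun a => measurable_ofDigits.comp (measurable_pi_apply a)
  have : IsProbabilityMeasure
      ((Measure.infinitePi fun _ : ℕ => unifDigit b).map Real.ofDigits) :=
    Measure.isProbabilityMeasure_map measurable_ofDigits.aemeasurable
  rw [Measure.infinitePi_eq_pi, Measure.pi_map_pi fun _ => measurable_ofDigits.aemeasurable,
    Measure.map_map hod (by fun_prop)] at h3
  exact h3.trans (congrArg Measure.pi (funext fun _ => map_ofDigits hb))

lemma measurable_unscramble (m : ℕ) :
    Measurable fun p : ((Fin m → Fin b) → Fin m → Fin b) × ((Fin m → Fin b) → ℝ) =>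
      unscramble p.1 p.2 :=
  measurable_from_prod_countable_right fun s =>
    measurable_pi_lambda _ fun k => measurable_pi_apply (Function.invFun s ((cellEquiv b m).symm k))

lemma map_unscramble {m : ℕ} {s : (Fin m → Fin b) → Fin m → Fin b} (hs : Function.Bijective s) :
    (Measure.pi fun _ : Fin m → Fin b => unif).map (unscramble s) =
      Measure.pi fun _ : Fin (b ^ m) => unif := by
  have hinj : Function.Injective fun k : Fin (b ^ m) =>
      Function.invFun s ((cellEquiv b m).symm k) :=
    (Function.rightInverse_invFun hs.2).injective.comp (cellEquiv b m).symm.injective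
  have h := Measure.map_infinitePi_infinitePi_of_inj (P := fun _ : Fin m → Fin b => unif) hinj
  rwa [Measure.infinitePi_eq_pi, Measure.infinitePi_eq_pi] at h

/-- The prefix reads only nodes of depth below m, the tails only nodes of depth at least m. -/
lemma IsNestedUniformScrambling.indepFun_scrambleString (hπ : IsNestedUniformScrambling P π)
    (m : ℕ) : IndepFun (fun ω => scrambleString m fun s => π s ω)
      (fun ω (a : Fin m → Fin b) => scrambledTail (fun s => π s ω) a) P := by
  have h := hπ.indep.indepFun_restrict hπ.measurable
    (S := {s : List (Fin b) | s.length < m}) (T := {s : List (Fin b) | m ≤ s.length})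
    (Set.disjoint_left.2 fun s (h1 : s.length < m) (h2 : m ≤ s.length) => not_lt.2 h2 h1)
  have h1 : ∀ (a : Fin m → Fin b) (j : Fin m),
      (List.ofFn fun k : Fin j => a ⟨k, k.2.trans j.2⟩) ∈ {s : List (Fin b) | s.length < m} := by
    intro a j; simp
  have h2 : ∀ (a : Fin m → Fin b) (j : ℕ),
      zeroExtension a j ∈ {s : List (Fin b) | m ≤ s.length} := by
    intro a j; simp [zeroExtension]
  refine h.comp (φ := fun x a j => x ⟨_, h1 a j⟩ (a j))
    (ψ := fun x a => Real.ofDigits fun j => x ⟨_, h2 a j⟩ 0) ?_ ?_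
  · refine measurable_pi_lambda _ fun a => measurable_pi_lambda _ fun j => ?_
    exact (measurable_of_finite fun τ : Equiv.Perm (Fin b) => τ (a j)).comp (measurable_pi_apply _)
  · refine measurable_pi_lambda _ fun a => measurable_ofDigits.comp ?_
    refine measurable_pi_lambda _ fun j => ?_
    exact (measurable_of_finite fun τ : Equiv.Perm (Fin b) => τ 0).comp (measurable_pi_apply _)

/-- The positions of the first `b^m` scrambled points within their intervals of length `b^{-m}`. -/
def positions (m : ℕ) (π : List (Fin b) → Ω → Equiv.Perm (Fin b)) (ω : Ω) : Fin (b ^ m) → ℝ :=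
  unscramble (scrambleString m fun s => π s ω) (scrambledTail fun s => π s ω)

lemma IsNestedUniformScrambling.measurable_scrambleString (hπ : IsNestedUniformScrambling P π)
    (m : ℕ) : Measurable fun ω => scrambleString m fun s => π s ω :=
  measurable_pi_lambda _ fun a => measurable_pi_lambda _ fun j =>
    (measurable_of_finite fun τ : Equiv.Perm (Fin b) => τ (a j)).comp (hπ.measurable _)

lemma IsNestedUniformScrambling.measurable_scrambledTail (hπ : IsNestedUniformScrambling P π)
    (m : ℕ) : Measurable fun ω (a : Fin m → Fin b) => scrambledTail (fun s => π s ω) a :=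
  measurable_pi_lambda _ fun _ => measurable_ofDigits.comp <| measurable_pi_lambda _ fun _ =>
    (measurable_of_finite fun τ : Equiv.Perm (Fin b) => τ 0).comp (hπ.measurable _)

lemma IsNestedUniformScrambling.measurable_positions (hπ : IsNestedUniformScrambling P π)
    (m : ℕ) : Measurable (positions m π) :=
  (measurable_unscramble m).comp
    ((hπ.measurable_scrambleString m).prodMk (hπ.measurable_scrambledTail m))

/-- The first `b^m` scrambled points form a stratified sample: the positions are independent and
uniformly distributed. -/
theorem IsNestedUniformScrambling.map_positions [IsProbabilityMeasure P] (hb : 2 ≤ b)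
    (hπ : IsNestedUniformScrambling P π) (m : ℕ) :
    P.map (positions m π) = Measure.pi fun _ => unif := by
  have hm1 := hπ.measurable_scrambleString m
  have hm2 := hπ.measurable_scrambledTail m
  have h1 := (indepFun_iff_map_prod_eq_prod_map_map hm1.aemeasurable hm2.aemeasurable).1
    (hπ.indepFun_scrambleString m)
  rw [hπ.map_scrambledTail hb] at h1
  have hprob : IsProbabilityMeasure (P.map fun ω => scrambleString m fun s => π s ω) :=
    Measure.isProbabilityMeasure_map hm1.aemeasurable
  -- For each fixed prefix permutation the relabelling preserves the i.i.d. uniform law; with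
  -- independence, a skew product preserves the joint law.
  have h2 : MeasurePreserving
      (fun p : ((Fin m → Fin b) → Fin m → Fin b) × ((Fin m → Fin b) → ℝ) =>
        (p.1, unscramble p.1 p.2))
      ((P.map fun ω => scrambleString m fun s => π s ω).prod (Measure.pi fun _ => unif))
      ((P.map fun ω => scrambleString m fun s => π s ω).prod
        (Measure.pi fun _ : Fin (b ^ m) => unif)) := by
    refine (MeasurePreserving.id _).skew_product (g := fun s r => unscramble s r)
      (measurable_unscramble m) ?_
    refine (ae_map_iff hm1.aemeasurable (Set.toFinite _).measurableSet).2
      (ae_of_all _ fun ω => map_unscramble (bijective_scrambleString m _))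
  have h3 := (measurePreserving_snd.comp h2).map_eq
  have h4 : (Prod.snd ∘ fun p : ((Fin m → Fin b) → Fin m → Fin b) × ((Fin m → Fin b) → ℝ) =>
      (p.1, unscramble p.1 p.2)) = fun p => unscramble p.1 p.2 := rfl
  rw [← h1, h4, Measure.map_map (measurable_unscramble m) (hm1.prodMk hm2)] at h3
  exact h3

end Scrambling

/-! ### A central limit theorem for small bounded summands -/

section CentralLimit

/-- Factors are exchanged one at a time, and the others have modulus at most 1. -/
lemma norm_prod_sub_prod_le {ι : Type*} (s : Finset ι) {a c : ι → ℂ} (ha : ∀ i ∈ s, ‖a i‖ ≤ 1)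
    (hc : ∀ i ∈ s, ‖c i‖ ≤ 1) : ‖∏ i ∈ s, a i - ∏ i ∈ s, c i‖ ≤ ∑ i ∈ s, ‖a i - c i‖ := by
  classical
  induction s using Finset.induction_on with
  | empty => simp
  | insert i s hi ih =>
    rw [Finset.prod_insert hi, Finset.prod_insert hi, Finset.sum_insert hi]
    have h1 := ih (fun k hk => ha k (Finset.mem_insert_of_mem hk))
      (fun k hk => hc k (Finset.mem_insert_of_mem hk))
    have h2 : ‖∏ k ∈ s, c k‖ ≤ 1 := by
      rw [norm_prod]
      exact Finset.prod_le_one (fun _ _ => norm_nonneg _)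
        fun k hk => hc k (Finset.mem_insert_of_mem hk)
    have h3 := ha i (Finset.mem_insert_self i s)
    calc ‖a i * ∏ k ∈ s, a k - c i * ∏ k ∈ s, c k‖
        = ‖a i * (∏ k ∈ s, a k - ∏ k ∈ s, c k) + (a i - c i) * ∏ k ∈ s, c k‖ := by ring_nf
      _ ≤ ‖a i‖ * ‖∏ k ∈ s, a k - ∏ k ∈ s, c k‖ + ‖a i - c i‖ * ‖∏ k ∈ s, c k‖ := by
        rw [← norm_mul, ← norm_mul]; exact norm_add_le _ _
      _ ≤ 1 * ∑ k ∈ s, ‖a k - c k‖ + ‖a i - c i‖ * 1 := by gcongr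
      _ = _ := by ring

/-- Both terms are compared with 1 - t²v/2, where v is the second moment. The Taylor remainder for
the characteristic function is controlled by |X|³ ≤ ε X²; each comparison costs at most |t|³ ε v. -/
lemma norm_charFun_sub_exp_le {Ω : Type*} [MeasurableSpace Ω] {ν : Measure Ω}
    [IsProbabilityMeasure ν] {X : Ω → ℝ} (hX : Measurable X) {ε : ℝ}
    (hb : ∀ᵐ ω ∂ν, |X ω| ≤ ε) (h0 : ∫ ω, X ω ∂ν = 0) {t : ℝ} (ht : |t| * ε ≤ 1) :
    ‖charFun (ν.map X) t - Complex.exp (-(t ^ 2 * ∫ ω, X ω ^ 2 ∂ν : ℝ) / 2)‖ ≤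
      2 * |t| ^ 3 * ε * ∫ ω, X ω ^ 2 ∂ν := by
  set v := ∫ ω, X ω ^ 2 ∂ν with hv
  have hε : 0 ≤ ε := by
    obtain ⟨ω, hω⟩ := hb.exists
    exact (abs_nonneg _).trans hω
  have hi1 : Integrable X ν := Integrable.of_bound hX.aestronglyMeasurable ε hb
  have hi2 : Integrable (fun ω => X ω ^ 2) ν :=
    Integrable.of_bound (hX.pow_const 2).aestronglyMeasurable (ε ^ 2) (hb.mono fun ω h => by
      rw [Real.norm_eq_abs, abs_pow]; exact pow_le_pow_left₀ (abs_nonneg _) h 2)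
  have hv0 : 0 ≤ v := integral_nonneg fun ω => sq_nonneg _
  have hvε : v ≤ ε ^ 2 := by
    have h := integral_mono_ae hi2 (integrable_const (ε ^ 2)) (hb.mono fun ω h => by
      simp only; rw [← sq_abs (X ω)]; exact pow_le_pow_left₀ (abs_nonneg _) h 2)
    simpa using h
  have hie : Integrable (fun ω => Complex.exp (t * X ω * Complex.I)) ν :=
    Integrable.of_bound (by fun_prop) 1 (ae_of_all _ fun ω => by
      rw [← Complex.ofReal_mul, Complex.norm_exp_ofReal_mul_I])
  have hchar : charFun (ν.map X) t = ∫ ω, Complex.exp (t * X ω * Complex.I) ∂ν := by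
    rw [charFun_apply_real, integral_map hX.aemeasurable (by fun_prop)]
  have hmom : ∫ ω, (1 + t * X ω * Complex.I - (t * X ω) ^ 2 / 2 : ℂ) ∂ν =
      1 - (t ^ 2 * v : ℝ) / 2 := by
    have e1 : ∀ ω, (1 + t * X ω * Complex.I - (t * X ω) ^ 2 / 2 : ℂ) =
        1 + (t * Complex.I) * ((X ω : ℝ) : ℂ) - (t ^ 2 / 2) * ((X ω ^ 2 : ℝ) : ℂ) := by
      intro ω; push_cast; ring
    simp_rw [e1]
    rw [integral_sub, integral_add, integral_const_mul, integral_const_mul,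
      integral_complex_ofReal, integral_complex_ofReal, h0, ← hv]
    · simp; ring
    · exact integrable_const _
    · exact hi1.ofReal.const_mul _
    · exact (integrable_const _).add (hi1.ofReal.const_mul _)
    · exact hi2.ofReal.const_mul _
  have hint : Integrable (fun ω => (1 + t * X ω * Complex.I - (t * X ω) ^ 2 / 2 : ℂ)) ν := by
    have e1 : ∀ ω, (1 + t * X ω * Complex.I - (t * X ω) ^ 2 / 2 : ℂ) =
        1 + (t * Complex.I) * ((X ω : ℝ) : ℂ) - (t ^ 2 / 2) * ((X ω ^ 2 : ℝ) : ℂ) := by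
      intro ω; push_cast; ring
    simp_rw [e1]
    exact ((integrable_const _).add (hi1.ofReal.const_mul _)).sub (hi2.ofReal.const_mul _)
  have hA : ‖charFun (ν.map X) t - (1 - (t ^ 2 * v : ℝ) / 2)‖ ≤ |t| ^ 3 * ε * v := by
    rw [hchar, ← hmom, ← integral_sub hie hint]
    have hle : ∀ᵐ ω ∂ν, ‖Complex.exp (t * X ω * Complex.I) -
        (1 + t * X ω * Complex.I - (t * X ω) ^ 2 / 2)‖ ≤ |t| ^ 3 * ε * X ω ^ 2 := by
      filter_upwards [hb] with ω hω
      have hn : ‖(t * X ω * Complex.I : ℂ)‖ = |t| * |X ω| := by simp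
      have hn1 : ‖(t * X ω * Complex.I : ℂ)‖ ≤ 1 := by
        rw [hn]; exact (mul_le_mul_of_nonneg_left hω (abs_nonneg _)).trans ht
      have h := Complex.exp_bound hn1 (n := 3) (by norm_num)
      have hs : ∑ k ∈ Finset.range 3, (t * X ω * Complex.I : ℂ) ^ k / k.factorial =
          1 + t * X ω * Complex.I - (t * X ω) ^ 2 / 2 := by
        simp only [Finset.sum_range_succ, Finset.sum_range_zero]
        simp [mul_pow]; ring
      rw [hs, hn] at h
      refine h.trans ?_
      have h3 : (|t| * |X ω|) ^ 3 * (((3 : ℕ).succ : ℝ) * (((3 : ℕ).factorial : ℝ) * (3 : ℕ))⁻¹) ≤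
          (|t| * |X ω|) ^ 3 := by
        refine mul_le_of_le_one_right (by positivity) ?_
        norm_num [Nat.factorial]
      refine h3.trans ?_
      rw [mul_pow, mul_assoc, ← sq_abs (X ω)]
      refine mul_le_mul_of_nonneg_left ?_ (by positivity)
      rw [pow_succ, mul_comm]
      exact mul_le_mul_of_nonneg_right hω (by positivity)
    refine (norm_integral_le_of_norm_le (hi2.const_mul _) hle).trans (le_of_eq ?_)
    rw [integral_const_mul]
  set y := t ^ 2 * v with hy
  have hy0 : 0 ≤ y := by positivity
  have hyv : y ≤ |t| * |t| * ε * ε := by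
    rw [hy, ← sq_abs]; nlinarith [sq_nonneg |t|]
  have hte : 0 ≤ |t| * ε := by positivity
  have hy1 : y ≤ 1 := by nlinarith
  have hB : ‖(1 - (y : ℝ) / 2 : ℂ) - Complex.exp (-(y : ℝ) / 2)‖ ≤ |t| ^ 3 * ε * v := by
    have h1 := Real.abs_exp_sub_one_sub_id_le (x := -y / 2)
      (by rw [abs_le]; constructor <;> linarith)
    have h2 : (1 - (y : ℝ) / 2 : ℂ) - Complex.exp (-(y : ℝ) / 2) =
        ((-(Real.exp (-y / 2) - 1 - -y / 2) : ℝ) : ℂ) := by push_cast; ring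
    rw [h2, Complex.norm_real, norm_neg, Real.norm_eq_abs]
    refine h1.trans ?_
    -- From v ≤ ε² and |t| ε ≤ 1 follows y ≤ (|t| ε)² ≤ |t| ε, which replaces one of the two factors
    -- y.
    have h4 : y * y ≤ |t| ^ 3 * ε * v := by
      have h5 : y ≤ |t| * ε := by nlinarith
      calc y * y ≤ (|t| * ε) * y := by gcongr
        _ = |t| ^ 3 * ε * v := by rw [hy, ← sq_abs]; ring
    nlinarith
  calc _ ≤ ‖charFun (ν.map X) t - (1 - (y : ℝ) / 2)‖ +
        ‖(1 - (y : ℝ) / 2 : ℂ) - Complex.exp (-(y : ℝ) / 2)‖ :=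
        norm_sub_le_norm_sub_add_norm_sub _ _ _
    _ ≤ _ := by linarith

/-- For independent centred variables with small uniform bounds the characteristic function of the
sum is close to the Gaussian one. -/
theorem norm_charFun_sum_sub_exp_le {ι : Type*} [Fintype ι] {Ω : Type*} [MeasurableSpace Ω]
    {ν : Measure Ω} [IsProbabilityMeasure ν] {X : ι → Ω → ℝ} (hX : ∀ k, Measurable (X k)) {ε : ℝ}
    (hb : ∀ k, ∀ᵐ ω ∂ν, |X k ω| ≤ ε) (h0 : ∀ k, ∫ ω, X k ω ∂ν = 0)
    (hv : ∑ k, ∫ ω, X k ω ^ 2 ∂ν = 1) {t : ℝ} (ht : |t| * ε ≤ 1) :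
    ‖charFun ((Measure.pi fun _ : ι => ν).map fun u => ∑ k, X k (u k)) t -
      Complex.exp (-t ^ 2 / 2)‖ ≤ 2 * |t| ^ 3 * ε := by
  have hm : ∀ k, Measurable fun u : ι → Ω => X k (u k) := fun k =>
    (hX k).comp (measurable_pi_apply k)
  have hind : iIndepFun (fun k (u : ι → Ω) => X k (u k)) (Measure.pi fun _ : ι => ν) :=
    iIndepFun_pi fun k => (hX k).aemeasurable
  have h1 := congrFun (hind.charFun_map_fun_sum_eq_prod fun k => (hm k).aemeasurable) t
  have hmap : ∀ k, (Measure.pi fun _ : ι => ν).map (fun u => X k (u k)) = ν.map (X k) := by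
    intro k
    have h2 := (measurePreserving_eval (fun _ : ι => ν) k).map_eq
    conv_rhs => rw [← h2]
    rw [Measure.map_map (hX k) (measurable_pi_apply k)]; rfl
  simp only [hmap, Finset.prod_apply] at h1
  have h2 : Complex.exp (-t ^ 2 / 2) =
      ∏ k, Complex.exp (-(t ^ 2 * ∫ ω, X k ω ^ 2 ∂ν : ℝ) / 2) := by
    rw [← Complex.exp_sum, ← Finset.sum_div, Finset.sum_neg_distrib, ← Complex.ofReal_sum,
      ← Finset.mul_sum, hv]
    simp
  rw [h1, h2]
  refine (norm_prod_sub_prod_le _ (fun k _ => ?_) fun k _ => ?_).trans ?_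
  · have : IsProbabilityMeasure (ν.map (X k)) :=
      Measure.isProbabilityMeasure_map (hX k).aemeasurable
    exact norm_charFun_le_one t
  · rw [Complex.norm_exp]
    refine Real.exp_le_one_iff.2 ?_
    have h3 : 0 ≤ t ^ 2 * ∫ ω, X k ω ^ 2 ∂ν :=
      mul_nonneg (sq_nonneg _) (integral_nonneg fun ω => sq_nonneg _)
    have h4 : (-(t ^ 2 * ∫ ω, X k ω ^ 2 ∂ν : ℝ) / 2 : ℂ) =
        ((-(t ^ 2 * ∫ ω, X k ω ^ 2 ∂ν) / 2 : ℝ) : ℂ) := by push_cast; ring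
    rw [h4, Complex.ofReal_re]
    linarith
  · refine (Finset.sum_le_sum fun k _ =>
      norm_charFun_sub_exp_le (hX k) (hb k) (h0 k) ht).trans (le_of_eq ?_)
    rw [← Finset.mul_sum, hv, mul_one]

end CentralLimit

/-! ### Stratified estimates -/

section Stratified

variable {F : ℝ → ℝ}

/-- The average of `F` over one point in each of `n` intervals of length `1/n`. -/
def stratifiedMean (F : ℝ → ℝ) (n : ℕ) (u : Fin n → ℝ) : ℝ :=
  (1 / (n : ℝ)) * ∑ k : Fin n, F (((k : ℕ) + u k) / n)

lemma exists_bound_of_continuous_unif (hF : Continuous F) :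
    ∃ C, ∀ᵐ x ∂unif, ‖F x‖ ≤ C := by
  obtain ⟨C, hC⟩ := isCompact_Icc.exists_bound_of_continuousOn (s := Set.Icc (0 : ℝ) 1)
    hF.continuousOn
  exact ⟨C, ae_unif_mem.mono hC⟩

lemma integrable_unif_of_continuous (hF : Continuous F) : Integrable F unif := by
  obtain ⟨C, hC⟩ := exists_bound_of_continuous_unif hF
  exact Integrable.of_bound hF.aestronglyMeasurable C hC

lemma memLp_unif_of_continuous (hF : Continuous F) : MemLp F 2 unif := by
  obtain ⟨C, hC⟩ := exists_bound_of_continuous_unif hF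
  exact MemLp.of_bound hF.aestronglyMeasurable C hC

lemma continuous_stratum (hF : Continuous F) (n k : ℕ) :
    Continuous fun x => F (((k : ℝ) + x) / n) := by fun_prop

lemma measurable_stratifiedMean (hF : Continuous F) (n : ℕ) :
    Measurable (stratifiedMean F n) := by
  unfold stratifiedMean
  exact Continuous.measurable (by fun_prop)

lemma variance_stratifiedMean (hF : Continuous F) (n : ℕ) :
    Var[stratifiedMean F n; Measure.pi fun _ => unif] =
      (1 / (n : ℝ)) ^ 2 * ∑ k ∈ Finset.range n, Var[fun x => F (((k : ℝ) + x) / n); unif] := by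
  have h1 : stratifiedMean F n = fun u => (1 / (n : ℝ)) *
      (∑ k : Fin n, fun u : Fin n → ℝ => F (((k : ℕ) + u k) / n)) u := by
    ext u; simp [stratifiedMean]
  rw [h1, variance_const_mul, Finset.sum_range, variance_sum_pi
    (X := fun (k : Fin n) x => F (((k : ℕ) + x) / n))
    fun k => memLp_unif_of_continuous (continuous_stratum hF n k)]

lemma sum_integral_stratum (hF : Continuous F) {n : ℕ} (hn : 0 < n) :
    (1 / (n : ℝ)) * ∑ k : Fin n, ∫ x, F (((k : ℕ) + x) / n) ∂unif = ∫ x, F x ∂unif := by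
  rw [integral_unif_eq_avg hn (integrable_unif_of_continuous hF), Finset.sum_range, Finset.mul_sum]

/-- The characteristic function of a standardized stratified estimate is close to the Gaussian
one. -/
theorem norm_charFun_stratifiedMean_sub_exp_le (hF : Continuous F) {n : ℕ} (hn : 0 < n) {r V : ℝ}
    (hr : ∀ k < n, ∃ c, ∀ x ∈ Set.Icc (0 : ℝ) 1, |F (((k : ℝ) + x) / n) - c| ≤ r)
    (hV : V = Var[stratifiedMean F n; Measure.pi fun _ => unif]) (hVpos : 0 < V) {t : ℝ}
    (ht : |t| * (2 * r / (n * √V)) ≤ 1) :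
    ‖charFun ((Measure.pi fun _ => unif).map fun u =>
        (stratifiedMean F n u - ∫ x, F x ∂unif) / √V) t - Complex.exp (-t ^ 2 / 2)‖ ≤
      2 * |t| ^ 3 * (2 * r / (n * √V)) := by
  have hn' : (0 : ℝ) < n := by exact_mod_cast hn
  have hs : 0 < √V := Real.sqrt_pos.2 hVpos
  have hns : 0 < n * √V := by positivity
  set mean : ℕ → ℝ := fun k => ∫ x, F (((k : ℝ) + x) / n) ∂unif with hmean
  have hint : ∀ k : ℕ, Integrable (fun x => F (((k : ℝ) + x) / n)) unif := fun k =>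
    integrable_unif_of_continuous (continuous_stratum hF n k)
  have hsum : ∀ u : Fin n → ℝ, (stratifiedMean F n u - ∫ x, F x ∂unif) / √V =
      ∑ k : Fin n, (F (((k : ℕ) + u k) / n) - mean k) / (n * √V) := by
    intro u
    rw [← sum_integral_stratum hF hn, stratifiedMean, ← mul_sub, ← Finset.sum_sub_distrib,
      ← Finset.sum_div, div_eq_div_iff hs.ne' hns.ne']
    field_simp
    rfl
  simp_rw [hsum]
  refine norm_charFun_sum_sub_exp_le (X := fun (k : Fin n) x =>
    (F (((k : ℕ) + x) / n) - mean k) / (n * √V)) (fun k => ?_) (fun k => ?_) (fun k => ?_) ?_ ht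
  · exact (((continuous_stratum hF n k).sub continuous_const).div_const _).measurable
  · obtain ⟨c, hc⟩ := hr k k.2
    -- The mean is as close to c as the values are, hence the factor 2 in 2r.
    have h1 : |mean k - c| ≤ r := by
      have h2 := norm_integral_le_of_norm_le_const (μ := unif)
        (f := fun x => F (((k : ℕ) + x) / n) - c) (C := r) (ae_unif_mem.mono fun x hx => hc x hx)
      rw [integral_sub (hint k) (integrable_const _)] at h2
      simpa using h2
    refine ae_unif_mem.mono fun x hx => ?_
    rw [abs_div, abs_of_pos hns]
    refine div_le_div_of_nonneg_right ?_ hns.le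
    have h3 := hc x hx
    rw [abs_le] at h1 h3 ⊢
    constructor <;> linarith [h1.1, h1.2, h3.1, h3.2]
  · rw [integral_div, integral_sub (hint k) (integrable_const _)]
    simp [hmean]
  · have h1 : ∀ k : Fin n, ∫ x, ((F (((k : ℕ) + x) / n) - mean k) / (n * √V)) ^ 2 ∂unif =
        Var[fun x => F (((k : ℕ) + x) / n); unif] / (n ^ 2 * V) := by
      intro k
      rw [variance_eq_integral (hint k).aemeasurable, ← integral_div]
      congr 1; ext x
      rw [div_pow, mul_pow, Real.sq_sqrt hVpos.le]
    simp_rw [h1]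
    rw [← Finset.sum_div]
    have h2 : ∑ k : Fin n, Var[fun x => F (((k : ℕ) + x) / n); unif] = n ^ 2 * V := by
      rw [hV, variance_stratifiedMean hF, Finset.sum_range]; field_simp
    rw [h2, div_self (by positivity)]

end Stratified

/-! ### The estimate -/

section Estimate

variable {d b : ℕ} [NeZero d] [NeZero b] {Ω : Type*} [MeasurableSpace Ω] {P : Measure Ω}
  {π : List (Fin b) → Ω → Equiv.Perm (Fin b)} {f : EuclideanSpace ℝ (Fin d) → ℝ}

lemma scrambledPoint_mem (σ : List (Fin b) → Equiv.Perm (Fin b)) (i : ℕ) :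
    scrambledPoint σ i ∈ Set.Icc (0 : ℝ) 1 := by
  rw [scrambledPoint_eq_ofDigits]
  exact ⟨Real.ofDigits_nonneg _, Real.ofDigits_le_one _⟩

/-- The integrand along the curve. -/
def along (f : EuclideanSpace ℝ (Fin d) → ℝ) (x : ℝ) : ℝ := f (extendedCurve d x)

lemma continuous_along (hf : ContinuousOn f (unitCube d)) : Continuous (along f) :=
  hf.comp_continuous continuous_extendedCurve extendedCurve_mem

lemma integral_along (hf : ContinuousOn f (unitCube d)) :
    ∫ x, along f x ∂unif = ∫ x in unitCube d, f x := by
  rw [← unifCube_eq, ← map_extendedCurve,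
    integral_map continuous_extendedCurve.measurable.aemeasurable]
  · rfl
  · rw [map_extendedCurve, unifCube_eq]
    exact hf.aestronglyMeasurable isClosed_unitCube.measurableSet

omit [MeasurableSpace Ω] in
lemma estimate_eq_stratifiedMean (f : EuclideanSpace ℝ (Fin d) → ℝ)
    (π : List (Fin b) → Ω → Equiv.Perm (Fin b)) (m : ℕ) (ω : Ω) :
    estimate f π (b ^ m) ω = stratifiedMean (along f) (b ^ m) (positions m π ω) := by
  have h := sum_scrambledPoint m (fun s => π s ω) (along f)
  simp only [estimate, stratifiedMean, positions]
  push_cast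
  rw [← h]
  congr 1
  refine Finset.sum_congr rfl fun i _ => ?_
  rw [along, extendedCurve_eq (scrambledPoint_mem _ i)]

lemma IsNestedUniformScrambling.variance_estimate [IsProbabilityMeasure P] (hb : 2 ≤ b)
    (hπ : IsNestedUniformScrambling P π) (hf : ContinuousOn f (unitCube d)) (m : ℕ) :
    Var[estimate f π (b ^ m); P] =
      Var[stratifiedMean (along f) (b ^ m); Measure.pi fun _ => unif] := by
  have hmp : MeasurePreserving (positions m π) P (Measure.pi fun _ => unif) :=
    ⟨hπ.measurable_positions m, hπ.map_positions hb m⟩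
  have h := hmp.variance_fun_comp
    (measurable_stratifiedMean (continuous_along hf) (b ^ m)).aemeasurable
  rw [← h]
  congr 1; ext ω
  exact estimate_eq_stratifiedMean f π m ω

/-- Asymptotic normality, when the strata contribute uniformly little. -/
theorem IsNestedUniformScrambling.tendstoInDistribution [IsProbabilityMeasure P] (hb : 2 ≤ b)
    (hπ : IsNestedUniformScrambling P π) (hf : ContinuousOn f (unitCube d)) {r : ℕ → ℝ}
    (hr : ∀ m, ∀ k < b ^ m, ∃ c, ∀ x ∈ Set.Icc (0 : ℝ) 1,
      |along f (((k : ℝ) + x) / (b ^ m : ℕ)) - c| ≤ r m)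
    (hpos : ∀ᶠ m in atTop, 0 < Var[estimate f π (b ^ m); P])
    (hlim : Tendsto (fun m => r m / ((b ^ m : ℕ) * √Var[estimate f π (b ^ m); P])) atTop (𝓝 0)) :
    TendstoInDistribution
      (fun (m : ℕ) ω => (estimate f π (b ^ m) ω - ∫ x in unitCube d, f x)
        / √(variance (estimate f π (b ^ m)) P))
      atTop (id : ℝ → ℝ) (fun _ => P) (gaussianReal 0 1) := by
  have hF := continuous_along hf
  have hstrat : ∀ m, Measurable fun u => (stratifiedMean (along f) (b ^ m) u -
      ∫ x, along f x ∂unif) / √Var[estimate f π (b ^ m); P] := fun m =>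
    ((measurable_stratifiedMean hF _).sub_const _).div_const _
  have hcomp : ∀ m, (fun ω => (estimate f π (b ^ m) ω - ∫ x in unitCube d, f x)
      / √(variance (estimate f π (b ^ m)) P)) = (fun u => (stratifiedMean (along f) (b ^ m) u -
      ∫ x, along f x ∂unif) / √Var[estimate f π (b ^ m); P]) ∘ positions m π := by
    intro m; ext ω
    rw [Function.comp, ← integral_along hf, ← estimate_eq_stratifiedMean]
  have hmeas : ∀ m, Measurable fun ω => (estimate f π (b ^ m) ω - ∫ x in unitCube d, f x)
      / √(variance (estimate f π (b ^ m)) P) := fun m => by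
    rw [hcomp]; exact (hstrat m).comp (hπ.measurable_positions m)
  refine ⟨fun m => (hmeas m).aemeasurable, aemeasurable_id, ?_⟩
  refine ProbabilityMeasure.tendsto_iff_tendsto_charFun.2 fun t => ?_
  simp only [ProbabilityMeasure.coe_mk, Measure.map_id, charFun_gaussianReal]
  have hgauss : Complex.exp (t * (0 : ℝ) * Complex.I - (1 : ℝ≥0) * t ^ 2 / 2) =
      Complex.exp (-t ^ 2 / 2) := by
    congr 1; push_cast; ring
  rw [hgauss, tendsto_iff_norm_sub_tendsto_zero]
  have hlim1 : Tendsto (fun m => 2 * r m / ((b ^ m : ℕ) * √Var[estimate f π (b ^ m); P]))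
      atTop (𝓝 0) := by
    simpa [mul_div_assoc] using hlim.const_mul 2
  have hlim2 : Tendsto (fun m => |t| * (2 * r m / ((b ^ m : ℕ) *
      √Var[estimate f π (b ^ m); P]))) atTop (𝓝 0) := by simpa using hlim1.const_mul |t|
  have hlim3 : Tendsto (fun m => 2 * |t| ^ 3 * (2 * r m / ((b ^ m : ℕ) *
      √Var[estimate f π (b ^ m); P]))) atTop (𝓝 0) := by
    simpa using hlim1.const_mul (2 * |t| ^ 3)
  refine tendsto_of_tendsto_of_tendsto_of_le_of_le' tendsto_const_nhds hlim3
    (Eventually.of_forall fun m => norm_nonneg _) ?_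
  filter_upwards [hpos, hlim2.eventually_le_const one_pos] with m hm hm2
  rw [hcomp, ← Measure.map_map (hstrat m) (hπ.measurable_positions m), hπ.map_positions hb]
  exact norm_charFun_stratifiedMean_sub_exp_le hF (pow_pos (NeZero.pos b) m) (hr m)
    (hπ.variance_estimate hb hf m) hm hm2

end Estimate

/-! ### The upper bound -/

section UpperBound

variable {d : ℕ} [NeZero d] {f : EuclideanSpace ℝ (Fin d) → ℝ}

lemma two_pow_mul_rpow (d j : ℕ) [NeZero d] : ((2 : ℝ) ^ (d * j)) ^ (1 / (d : ℝ)) = 2 ^ j := by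
  have hd : (d : ℝ) ≠ 0 := by exact_mod_cast NeZero.ne d
  rw [← Real.rpow_natCast, ← Real.rpow_mul (by norm_num), ← Real.rpow_natCast]
  congr 1; push_cast; field_simp

/-- There is a level whose cells are comparable to intervals of length `1/n`. -/
lemma exists_level (d : ℕ) [NeZero d] {n : ℕ} (hn : 0 < n) :
    ∃ j : ℕ, 2 ^ (d * j) ≤ n ∧ (1 / 2 : ℝ) ^ j ≤ 2 * (n : ℝ) ^ (-1 / (d : ℝ)) := by
  have hd := NeZero.pos d
  have hbase : 1 < 2 ^ d := Nat.one_lt_two_pow hd.ne'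
  have hn' : (0 : ℝ) < n := by exact_mod_cast hn
  refine ⟨Nat.log (2 ^ d) n, ?_, ?_⟩
  · rw [pow_mul]; exact Nat.pow_log_le_self _ hn.ne'
  · set j := Nat.log (2 ^ d) n
    have h1 : (n : ℝ) ≤ 2 ^ (d * (j + 1)) := by
      rw [pow_mul]; exact_mod_cast (Nat.lt_pow_succ_log_self hbase n).le
    have h2 : (n : ℝ) ^ (1 / (d : ℝ)) ≤ 2 ^ (j + 1) := by
      rw [← two_pow_mul_rpow d (j + 1)]
      exact Real.rpow_le_rpow hn'.le h1 (by positivity)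
    have h3 : 0 < (n : ℝ) ^ (1 / (d : ℝ)) := Real.rpow_pos_of_pos hn' _
    rw [neg_div, Real.rpow_neg hn'.le, one_div, inv_pow, ← div_eq_mul_inv,
      inv_le_iff_one_le_mul₀ (by positivity), ← mul_div_right_comm, le_div_iff₀ h3]
    rw [pow_succ] at h2
    linarith

/-- Within each of `n` intervals of equal length the curve stays close to one of its points. -/
lemma exists_norm_extendedCurve_sub_le {n k : ℕ} (hk : k < n) :
    ∃ z ∈ unitCube d, ∀ x ∈ Set.Icc (0 : ℝ) 1,
      ‖extendedCurve d (((k : ℝ) + x) / n) - z‖ ≤ 2 * √d * (n : ℝ) ^ (-1 / (d : ℝ)) := by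
  have hn : 0 < n := by omega
  have hn' : (0 : ℝ) < n := by exact_mod_cast hn
  obtain ⟨j, hj, hj2⟩ := exists_level d hn
  have hj' : (2 : ℝ) ^ (d * j) ≤ n := by exact_mod_cast hj
  have h1 := add_div_mem_Icc hk (x := 0) (by simp)
  have h2 := add_div_mem_Icc hk (x := 1) (by simp)
  obtain ⟨z, hz, hzx⟩ := exists_norm_hilbertCurve_sub_le (d := d) j (a := (k : ℝ) / n)
    (ℓ := 1 / n) (by positivity) (by positivity) (by rw [← add_div]; exact h2.2)
    (by rw [mul_one_div, div_le_one hn']; exact hj')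
  refine ⟨hilbertCurve d z, hilbertCurve_mem hz, fun x hx => ?_⟩
  rw [extendedCurve_eq (add_div_mem_Icc hk hx)]
  refine (hzx _ ⟨?_, ?_⟩).trans ?_
  · have := hx.1; gcongr; linarith
  · rw [← add_div]; have := hx.2; gcongr
  · calc _ ≤ 2 * (n : ℝ) ^ (-1 / (d : ℝ)) * √d := by gcongr
      _ = _ := by ring

lemma exists_abs_along_sub_le {M : ℝ≥0} (hf : LipschitzOnWith M f (unitCube d)) {n k : ℕ}
    (hk : k < n) : ∃ c, ∀ x ∈ Set.Icc (0 : ℝ) 1,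
      |along f (((k : ℝ) + x) / n) - c| ≤ M * (2 * √d * (n : ℝ) ^ (-1 / (d : ℝ))) := by
  obtain ⟨z, hz, hzx⟩ := exists_norm_extendedCurve_sub_le (d := d) hk
  refine ⟨f z, fun x hx => ?_⟩
  have h := hf.dist_le_mul _ (extendedCurve_mem (((k : ℝ) + x) / n)) _ hz
  rw [dist_eq_norm, dist_eq_norm, Real.norm_eq_abs] at h
  exact h.trans (mul_le_mul_of_nonneg_left (hzx x hx) M.2)

/-- The upper bound for the variance of a stratified estimate along Hilbert's curve. -/
theorem variance_stratifiedMean_le {M : ℝ≥0} (hf : LipschitzOnWith M f (unitCube d)) {n : ℕ}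
    (hn : 0 < n) : Var[stratifiedMean (along f) n; Measure.pi fun _ => unif] ≤
      4 * (M : ℝ) ^ 2 * ((d : ℝ) + 3) * (n : ℝ) ^ (-1 - 2 / (d : ℝ)) := by
  have hn' : (0 : ℝ) < n := by exact_mod_cast hn
  have hF := continuous_along hf.continuousOn
  set ρ := (n : ℝ) ^ (-1 / (d : ℝ)) with hρ
  have hk : ∀ k ∈ Finset.range n, Var[fun x => along f (((k : ℝ) + x) / n); unif] ≤
      4 * (M : ℝ) ^ 2 * d * ρ ^ 2 := by
    intro k hk
    obtain ⟨c, hc⟩ := exists_abs_along_sub_le hf (Finset.mem_range.1 hk)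
    rw [← hρ] at hc
    have hc' : ∀ᵐ x ∂unif, along f (((k : ℝ) + x) / n) ∈
        Set.Icc (c - M * (2 * √d * ρ)) (c + M * (2 * √d * ρ)) := ae_unif_mem.mono fun x hx => by
      have := abs_le.1 (hc x hx)
      constructor <;> linarith [this.1, this.2]
    refine (variance_le_sq_of_bounded hc' (continuous_stratum hF n k).measurable.aemeasurable).trans
      (le_of_eq ?_)
    have : √(d : ℝ) ^ 2 = d := Real.sq_sqrt (by positivity)
    calc _ = (M : ℝ) ^ 2 * 4 * √(d : ℝ) ^ 2 * ρ ^ 2 := by ring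
      _ = _ := by rw [this]; ring
  have hpow : (n : ℝ) ^ (-1 - 2 / (d : ℝ)) = (1 / n) * ρ ^ 2 := by
    rw [hρ, ← Real.rpow_natCast, ← Real.rpow_mul hn'.le, sub_eq_add_neg, Real.rpow_add hn',
      Real.rpow_neg_one, one_div]
    congr 2; push_cast; ring
  rw [variance_stratifiedMean hF, hpow]
  calc _ ≤ (1 / (n : ℝ)) ^ 2 * ∑ _k ∈ Finset.range n, 4 * (M : ℝ) ^ 2 * d * ρ ^ 2 := by
        gcongr with k hk'; exact hk k hk'
    _ = 4 * (M : ℝ) ^ 2 * d * ((1 / n) * ρ ^ 2) := by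
        rw [Finset.sum_const, Finset.card_range, nsmul_eq_mul]; field_simp
    -- The argument gives the factor d, which is relaxed to d + 3.
    _ ≤ _ := by gcongr; linarith

end UpperBound

/-! ### The lower bound -/

section LowerBound

variable {d : ℕ}

lemma integral_unif_pow (k : ℕ) : ∫ x, x ^ k ∂unif = 1 / (k + 1) := by
  rw [integral_unif, integral_pow]; simp

lemma variance_unif_mul (w : ℝ) : Var[fun x => w * x; unif] = w ^ 2 / 12 := by
  have hm : MemLp (fun x : ℝ => x) 2 unif := memLp_unif_of_continuous continuous_id
  rw [variance_const_mul, variance_eq_sub hm]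
  have h1 := integral_unif_pow 1
  have h2 := integral_unif_pow 2
  simp only [pow_one] at h1
  simp only [Pi.pow_apply, h1, h2]
  norm_num
  ring

lemma variance_unifCube_linear (w : Fin d → ℝ) :
    Var[fun x : EuclideanSpace ℝ (Fin d) => ∑ i, w i * x i; unifCube d] = (∑ i, w i ^ 2) / 12 := by
  have hmp : MeasurePreserving (WithLp.toLp 2) (Measure.pi fun _ : Fin d => unif) (unifCube d) :=
    ⟨measurable_toLp_fin, rfl⟩
  have hc : Continuous fun x : EuclideanSpace ℝ (Fin d) => ∑ i, w i * x i := by fun_prop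
  rw [← hmp.variance_fun_comp hc.measurable.aemeasurable]
  have h := variance_sum_pi (μ := fun _ : Fin d => unif) (X := fun i x => w i * x)
    fun i => memLp_unif_of_continuous (by fun_prop)
  simp only [variance_unif_mul, ← Finset.sum_div] at h
  rw [← h]
  congr 1; ext y; simp

/-- A function on a small subcube varies at least as much as its linear part. -/
lemma cell_lower_bound {f : EuclideanSpace ℝ (Fin d) → ℝ} (hf : ContinuousOn f (unitCube d))
    {j : ℕ} {T : EuclideanSpace ℝ (Fin d) → EuclideanSpace ℝ (Fin d)}
    (hT : IsDyadicSimilarity j T) {g : EuclideanSpace ℝ (Fin d)} {B : ℝ}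
    (hB : ∀ x ∈ unitCube d, |f (T x) - f (T 0) - inner ℝ g (T x - T 0)| ≤ B) (a : ℝ) {δ : ℝ}
    (hδ : 0 < δ) (hδ1 : δ ≤ 1) :
    (1 - δ) * ((1 / 4) ^ j * ‖g‖ ^ 2 / 12) - B ^ 2 / δ ≤ ∫ x, (f (T x) - a) ^ 2 ∂unifCube d := by
  have hTc := hT.lipschitzWith.continuous
  obtain ⟨ρ, s, ε, hε, hTy, hTcube⟩ := hT
  set Y : EuclideanSpace ℝ (Fin d) → ℝ := fun x => (f (T 0) - a) + inner ℝ g (T x - T 0) with hY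
  have hYc : Continuous Y := by fun_prop
  have hbdd : ∀ φ : EuclideanSpace ℝ (Fin d) → ℝ, ContinuousOn φ (unitCube d) →
      Integrable φ (unifCube d) := by
    intro φ hφ
    rw [unifCube_eq]
    exact hφ.integrableOn_compact isCompact_unitCube
  have hfT : ContinuousOn (fun x => f (T x)) (unitCube d) :=
    hf.comp hTc.continuousOn hTcube
  have hvar : Var[Y; unifCube d] = (1 / 4) ^ j * ‖g‖ ^ 2 / 12 := by
    set w : Fin d → ℝ := fun k => (1 / 2) ^ j * (g (ρ.symm k) * ε (ρ.symm k)) with hw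
    have h1 : Y = fun x => (∑ i, w i * x i) - -(f (T 0) - a) := by
      ext x
      have h2 : inner ℝ g (T x - T 0) = ∑ i, w i * x i := by
        rw [← Equiv.sum_comp ρ, PiLp.inner_apply]
        refine Finset.sum_congr rfl fun i _ => ?_
        simp [hw, hTy]; ring
      simp only [hY, h2]; ring
    rw [h1, variance_sub_const (Continuous.aestronglyMeasurable (by fun_prop)),
      variance_unifCube_linear]
    congr 1
    have h3 : ∀ k, w k ^ 2 = (1 / 4) ^ j * g (ρ.symm k) ^ 2 := by
      intro k
      simp only [hw, mul_pow, ← pow_mul, mul_comm j 2]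
      rw [pow_mul]
      rcases hε (ρ.symm k) with h | h <;> rw [h] <;> norm_num
    simp_rw [h3]
    rw [← Finset.mul_sum, Equiv.sum_comp ρ.symm fun k => g k ^ 2, EuclideanSpace.norm_sq_eq]
    simp
  -- Bounding the second moment below by the variance holds for every a; later a is the mean of the
  -- whole stratum, not of this cell.
  have hY2 : (1 / 4) ^ j * ‖g‖ ^ 2 / 12 ≤ ∫ x, Y x ^ 2 ∂unifCube d := by
    rw [← hvar]
    exact variance_le_expectation_sq hYc.aestronglyMeasurable
  have hpt : ∀ x ∈ unitCube d, (1 - δ) * Y x ^ 2 - B ^ 2 / δ ≤ (f (T x) - a) ^ 2 := by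
    intro x hx
    have h1 := hB x hx
    set R := f (T x) - f (T 0) - inner ℝ g (T x - T 0) with hR
    have h2 : f (T x) - a = Y x + R := by rw [hR, hY]; ring
    have h3 : R ^ 2 ≤ B ^ 2 := by
      rw [← sq_abs R]; exact pow_le_pow_left₀ (abs_nonneg _) h1 2
    have h4 : R ^ 2 / δ ≤ B ^ 2 / δ := by gcongr
    -- Young's inequality with weight δ, as an identity with nonnegative remainder.
    have h5 : (Y x + R) ^ 2 - ((1 - δ) * Y x ^ 2 - R ^ 2 / δ) = (δ * Y x + R) ^ 2 / δ + R ^ 2 := by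
      field_simp; ring
    have h6 : 0 ≤ (δ * Y x + R) ^ 2 / δ := by positivity
    rw [h2]
    nlinarith [sq_nonneg R]
  have hint := integral_mono_ae
    (((hbdd (fun x => Y x ^ 2) (hYc.pow 2).continuousOn).const_mul (1 - δ)).sub
      (integrable_const (B ^ 2 / δ)))
    (hbdd (fun x => (f (T x) - a) ^ 2) ((hfT.sub continuousOn_const).pow 2))
    (ae_unifCube_mem.mono hpt)
  rw [integral_sub' ((hbdd (fun x => Y x ^ 2) (hYc.pow 2).continuousOn).const_mul (1 - δ))
    (integrable_const _), integral_const_mul] at hint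
  simp only [integral_const, probReal_univ, one_smul] at hint
  refine le_trans ?_ hint
  have : 0 ≤ 1 - δ := by linarith
  gcongr

/-- An interval of length `1/n` dominates the intervals of length `1/N` that it contains. -/
lemma sum_integral_subcells_le {g : ℝ → ℝ} (hg : Continuous g) (hg0 : ∀ x, 0 ≤ g x)
    {n N k q c : ℕ} (hn : 0 < n) (hN : 0 < N) (h1 : k * N ≤ q * n) (h2 : (q + c) * n ≤ (k + 1) * N) :
    (n / N : ℝ) * ∑ i ∈ Finset.range c, ∫ x, g ((((q + i : ℕ) : ℝ) + x) / N) ∂unif ≤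
      ∫ x, g (((k : ℝ) + x) / n) ∂unif := by
  have hn' : (0 : ℝ) < n := by exact_mod_cast hn
  have hN' : (0 : ℝ) < N := by exact_mod_cast hN
  have h1' : (k : ℝ) * N ≤ q * n := by exact_mod_cast h1
  have h2' : ((q + c : ℕ) : ℝ) * n ≤ (k + 1 : ℕ) * N := by exact_mod_cast h2
  simp_rw [integral_unif_comp_add_div hN, integral_unif_comp_add_div hn]
  have h3 := intervalIntegral.sum_integral_adjacent_intervals (μ := volume) (f := g)
    (a := fun i : ℕ => ((q + i : ℕ) : ℝ) / N) (n := c) fun i _ => hg.intervalIntegrable _ _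
  rw [← Finset.mul_sum]
  simp only [← add_assoc, add_zero] at h3 ⊢
  rw [h3, ← mul_assoc, div_mul_cancel₀ _ hN'.ne']
  refine mul_le_mul_of_nonneg_left ?_ hn'.le
  refine intervalIntegral.integral_mono_interval ?_ ?_ ?_ (ae_of_all _ hg0)
    (hg.intervalIntegrable _ _)
  · rwa [div_le_div_iff₀ hn' hN']
  · gcongr; omega
  · rwa [div_le_div_iff₀ hN' hn']

lemma convex_unitCube : Convex ℝ (unitCube d) := by
  intro x hx y hy a b ha hb hab i
  exact convex_Icc (0 : ℝ) 1 (hx i) (hy i) ha hb hab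

/-- A convex set with nonempty interior; this makes derivatives within the closed cube unique, so
that they are continuous up to the boundary for C¹ functions. -/
lemma uniqueDiffOn_unitCube : UniqueDiffOn ℝ (unitCube d) := by
  refine uniqueDiffOn_convex convex_unitCube ?_
  have ho : IsOpen {x : EuclideanSpace ℝ (Fin d) | ∀ i, x i ∈ Set.Ioo (0 : ℝ) 1} := by
    simp only [Set.ofPred_forall]
    exact isOpen_iInter_of_finite fun i =>
      isOpen_Ioo.preimage (EuclideanSpace.proj (𝕜 := ℝ) i).continuous
  refine ⟨WithLp.toLp 2 fun _ => 1 / 2, interior_maximal (fun x hx i => ?_) ho fun i => ?_⟩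
  · exact Set.Ioo_subset_Icc_self (hx i)
  · norm_num

variable {f : EuclideanSpace ℝ (Fin d) → ℝ}

lemma continuousOn_gradientWithin (hf : ContDiffOn ℝ 1 f (unitCube d)) :
    ContinuousOn (gradientWithin f (unitCube d)) (unitCube d) :=
  (InnerProductSpace.toDual ℝ (EuclideanSpace ℝ (Fin d))).symm.continuous.comp_continuousOn
    (hf.continuousOn_fderivWithin uniqueDiffOn_unitCube le_rfl)

lemma exists_lipschitzOnWith (hf : ContDiffOn ℝ 1 f (unitCube d)) :
    ∃ M : ℝ≥0, LipschitzOnWith M f (unitCube d) := by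
  obtain ⟨C, hC⟩ := isCompact_unitCube.exists_bound_of_continuousOn
    (hf.continuousOn_fderivWithin uniqueDiffOn_unitCube le_rfl)
  refine ⟨C.toNNReal, convex_unitCube.lipschitzOnWith_of_nnnorm_fderivWithin_le
    (hf.differentiableOn one_ne_zero) fun x hx => ?_⟩
  rw [← NNReal.coe_le_coe, coe_nnnorm]
  exact (hC x hx).trans (Real.le_coe_toNNReal C)

/-- A continuously differentiable function is uniformly approximated by its linear parts. -/
lemma exists_uniform_linear_approx (hf : ContDiffOn ℝ 1 f (unitCube d)) {ε : ℝ} (hε : 0 < ε) :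
    ∃ r > 0, ∀ x ∈ unitCube d, ∀ y ∈ unitCube d, ‖y - x‖ < r →
      |f y - f x - inner ℝ (gradientWithin f (unitCube d) x) (y - x)| ≤ ε * ‖y - x‖ := by
  have huc := isCompact_unitCube.uniformContinuousOn_of_continuous
    (hf.continuousOn_fderivWithin uniqueDiffOn_unitCube le_rfl)
  obtain ⟨r, hr, hrx⟩ := Metric.uniformContinuousOn_iff.1 huc ε hε
  refine ⟨r, hr, fun x hx y hy hxy => ?_⟩
  -- On this convex piece the derivative differs from its value at x by at most ε, and the mean
  -- value inequality applies.
  have hs : Convex ℝ (unitCube d ∩ Metric.ball x r) := convex_unitCube.inter (convex_ball x r)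
  have h := hs.norm_image_sub_le_of_norm_hasFDerivWithin_le' (f := f)
    (f' := fderivWithin ℝ f (unitCube d)) (φ := fderivWithin ℝ f (unitCube d) x) (C := ε)
    (fun z hz => ((hf.differentiableOn one_ne_zero z hz.1).hasFDerivWithinAt).mono
      Set.inter_subset_left)
    (fun z hz => by
      rw [← dist_eq_norm]; exact (hrx z hz.1 x hx hz.2).le)
    (x := x) (y := y) ⟨hx, Metric.mem_ball_self hr⟩
    ⟨hy, by rwa [Metric.mem_ball, dist_eq_norm]⟩
  rwa [inner_gradientWithin_left]

variable [NeZero d]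

/-- There is a level whose cells fit at least twice, but not much more often, into an interval of
length `1/n`. -/
lemma exists_fine_level (d : ℕ) [NeZero d] {n : ℕ} (hn : 0 < n) :
    ∃ j : ℕ, 2 * n ≤ 2 ^ (d * j) ∧ 2 ^ (d * j) ≤ 2 ^ (d + 1) * n := by
  have hbase : 1 < 2 ^ d := Nat.one_lt_two_pow (NeZero.ne d)
  refine ⟨Nat.clog (2 ^ d) (2 * n), ?_, ?_⟩
  · rw [pow_mul]; exact Nat.le_pow_clog hbase _
  · have h1 := Nat.pow_pred_clog_lt_self hbase (x := 2 * n) (by omega)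
    have h2 := Nat.clog_pos hbase (show 2 ≤ 2 * n by omega)
    obtain ⟨i, hi⟩ := Nat.exists_eq_succ_of_ne_zero h2.ne'
    rw [hi, Nat.pred_succ] at h1
    rw [hi, pow_mul, Nat.succ_eq_add_one, pow_succ, pow_succ]
    nlinarith

/-- With N = 2^{dj}, p = -1 - 2/d and X = 2^{d+1} n, the claim reads 8 X^p ≤ 6c N^p. For c = 2, N ≤
X suffices. For c = 1, N < 3n ≤ 3X/4 gains the factor (3/4)^p ≥ 4/3, just enough for the constant
96. -/
lemma fine_level_rpow_le {n j c : ℕ} (hn : 0 < n) (hj : 2 ^ (d * j) ≤ 2 ^ (d + 1) * n)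
    (hc : c = 2 ∨ c = 1 ∧ 2 ^ (d * j) < 3 * n) :
    1 / 96 * (2 : ℝ) ^ (-2 / (d : ℝ) - d) * (n : ℝ) ^ (-1 - 2 / (d : ℝ)) ≤
      c / 2 ^ (d * j) * (1 / 4) ^ j / 16 := by
  have hd : (0 : ℝ) < d := by exact_mod_cast NeZero.pos d
  have hn' : (0 : ℝ) < n := by exact_mod_cast hn
  set p : ℝ := -1 - 2 / (d : ℝ) with hp
  have hp1 : p ≤ -1 := by
    have : 0 ≤ 2 / (d : ℝ) := by positivity
    linarith
  have hN : (0 : ℝ) < 2 ^ (d * j) := by positivity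
  have hX : (0 : ℝ) < 2 ^ (d + 1) * n := by positivity
  have e1 : (1 : ℝ) / 2 ^ (d * j) * (1 / 4) ^ j = ((2 : ℝ) ^ (d * j)) ^ p := by
    rw [← Real.rpow_natCast, ← Real.rpow_mul (by norm_num), one_div, ← Real.rpow_neg (by norm_num),
      show (1 / 4 : ℝ) = 2 ^ (-2 : ℝ) by rw [Real.rpow_neg (by norm_num)]; norm_num,
      ← Real.rpow_natCast, ← Real.rpow_mul (by norm_num), ← Real.rpow_add (by norm_num)]
    congr 1; rw [hp]; push_cast; field_simp; ring
  have e2 : (2 : ℝ) ^ (-2 / (d : ℝ) - d) * (n : ℝ) ^ p = 8 * ((2 : ℝ) ^ (d + 1) * n) ^ p := by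
    rw [Real.mul_rpow (by positivity) hn'.le, ← mul_assoc]
    congr 1
    rw [← Real.rpow_natCast 2 (d + 1), ← Real.rpow_mul (by norm_num),
      show (8 : ℝ) = 2 ^ (3 : ℝ) by norm_num, ← Real.rpow_add (by norm_num)]
    congr 1; rw [hp]; push_cast; field_simp; ring
  have hj' : (2 : ℝ) ^ (d * j) ≤ 2 ^ (d + 1) * n := by exact_mod_cast hj
  have key : 8 * ((2 : ℝ) ^ (d + 1) * n) ^ p ≤ 6 * c * ((2 : ℝ) ^ (d * j)) ^ p := by
    have hXp : 0 < ((2 : ℝ) ^ (d + 1) * n) ^ p := Real.rpow_pos_of_pos hX p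
    rcases hc with rfl | ⟨rfl, h3⟩
    · have := Real.rpow_le_rpow_of_nonpos hN hj' (by linarith : p ≤ 0)
      push_cast; linarith
    · have h4 : (2 : ℝ) ^ (d * j) ≤ 3 / 4 * (2 ^ (d + 1) * n) := by
        have h5 : (2 : ℝ) ^ (d * j) ≤ 3 * n := by exact_mod_cast h3.le
        have h6 : (2 : ℝ) ^ 2 ≤ 2 ^ (d + 1) :=
          pow_le_pow_right₀ (by norm_num) (by have := NeZero.pos d; omega)
        nlinarith
      have h7 := Real.rpow_le_rpow_of_nonpos hN h4 (by linarith : p ≤ 0)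
      rw [Real.mul_rpow (by norm_num) hX.le] at h7
      have h8 : (4 / 3 : ℝ) ≤ (3 / 4 : ℝ) ^ p := by
        have := Real.rpow_le_rpow_of_exponent_ge (x := 3 / 4) (by norm_num) (by norm_num) hp1
        rw [Real.rpow_neg_one] at this
        norm_num at this ⊢; exact this
      have h9 : 4 / 3 * ((2 : ℝ) ^ (d + 1) * n) ^ p ≤
          (3 / 4 : ℝ) ^ p * ((2 : ℝ) ^ (d + 1) * n) ^ p := by gcongr
      push_cast; linarith
  calc _ = 1 / 96 * ((2 : ℝ) ^ (-2 / (d : ℝ) - d) * (n : ℝ) ^ p) := by ring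
    _ = 1 / 96 * (8 * ((2 : ℝ) ^ (d + 1) * n) ^ p) := by rw [e2]
    _ ≤ 1 / 96 * (6 * c * ((2 : ℝ) ^ (d * j)) ^ p) := by gcongr
    _ = c / 16 * (1 / 2 ^ (d * j) * (1 / 4) ^ j) := by rw [e1]; ring
    _ = _ := by ring

/-- Here q = ⌈kN/n⌉. Rounding up to the grid loses less than one cell, which the extra 1 in c + 1
pays for. -/
lemma exists_first_subcell {n N k c : ℕ} (hn : 0 < n) (hc : (c + 1) * n ≤ N) :
    ∃ q, k * N ≤ q * n ∧ (q + c) * n ≤ (k + 1) * N := by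
  refine ⟨(k * N + (n - 1)) / n, ?_, ?_⟩
  · have h1 := Nat.div_add_mod (k * N + (n - 1)) n
    have h2 := Nat.mod_lt (k * N + (n - 1)) hn
    have h3 : n * ((k * N + (n - 1)) / n) = (k * N + (n - 1)) / n * n := mul_comm _ _
    omega
  · have h1 := Nat.div_mul_le_self (k * N + (n - 1)) n
    have h4 : (c + 1) * n = c * n + n := by ring
    rw [add_mul, add_mul, one_mul]
    omega

/-- The variance within one of `n` intervals, in terms of the gradient along it. -/
lemma stratum_lower_bound (hf : ContinuousOn f (unitCube d))
    {g : EuclideanSpace ℝ (Fin d) → EuclideanSpace ℝ (Fin d)} (hg : ContinuousOn g (unitCube d))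
    {n k j c : ℕ} (hk : k < n)
    (hc : (c + 1) * n ≤ 2 ^ (d * j)) {ε η r : ℝ} (hε : 0 ≤ ε)
    (hlin : ∀ x ∈ unitCube d, ∀ y ∈ unitCube d, ‖y - x‖ < r →
      |f y - f x - inner ℝ (g x) (y - x)| ≤ ε * ‖y - x‖)
    (hgrad : ∀ x ∈ unitCube d, ∀ y ∈ unitCube d, ‖y - x‖ < r → ‖g y‖ ^ 2 ≤ ‖g x‖ ^ 2 + η)
    (hr1 : (1 / 2) ^ j * √d < r) (hr2 : 4 * √d * (n : ℝ) ^ (-1 / (d : ℝ)) < r) :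
    (n / 2 ^ (d * j) : ℝ) * c * (1 / 4) ^ j * (15 / 16 *
        ((∫ x, ‖g (extendedCurve d (((k : ℝ) + x) / n))‖ ^ 2 ∂unif) - η) / 12 - 16 * ε ^ 2 * d) ≤
      Var[fun x => along f (((k : ℝ) + x) / n); unif] := by
  have hn : 0 < n := by omega
  have hn' : (0 : ℝ) < n := by exact_mod_cast hn
  have hN : 0 < 2 ^ (d * j) := by positivity
  have hF := continuous_along hf
  have hstr := continuous_stratum hF n k
  set a := ∫ x, along f (((k : ℝ) + x) / n) ∂unif with ha
  set G := ∫ x, ‖g (extendedCurve d (((k : ℝ) + x) / n))‖ ^ 2 ∂unif with hG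
  rw [variance_eq_integral hstr.measurable.aemeasurable, ← ha]
  obtain ⟨q, hq1, hq2⟩ := exists_first_subcell (k := k) hn hc
  -- Squared deviations from the stratum mean are nonnegative, so the parts of the stratum outside
  -- the whole cells can be dropped.
  have hsub := sum_integral_subcells_le (g := fun x => (along f x - a) ^ 2)
    (by fun_prop) (fun x => sq_nonneg _) hn hN hq1 hq2
  refine le_trans ?_ hsub
  have hcell : ∀ i ∈ Finset.range c, (1 / 4) ^ j * (15 / 16 * (G - η) / 12 - 16 * ε ^ 2 * d) ≤
      ∫ x, (along f ((((q + i : ℕ) : ℝ) + x) / (2 ^ (d * j) : ℕ)) - a) ^ 2 ∂unif := by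
    intro i hi
    have hi' := Finset.mem_range.1 hi
    have hqi : q + i < 2 ^ (d * j) := by
      have h1 : (q + i + 1) * n ≤ n * 2 ^ (d * j) :=
        calc (q + i + 1) * n ≤ (q + c) * n := Nat.mul_le_mul_right n (by omega)
          _ ≤ (k + 1) * 2 ^ (d * j) := hq2
          _ ≤ n * 2 ^ (d * j) := Nat.mul_le_mul_right _ hk
      have := Nat.le_of_mul_le_mul_left
        (by rwa [mul_comm n (q + i + 1)] : n * (q + i + 1) ≤ n * 2 ^ (d * j)) hn
      omega
    obtain ⟨T, hT, hTx⟩ := exists_isDyadicSimilarity (d := d) j (q + i) hqi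
    have hTcube : ∀ y ∈ unitCube d, T y ∈ unitCube d := by
      obtain ⟨_, _, _, _, _, h⟩ := hT; exact h
    have h0 : (0 : EuclideanSpace ℝ (Fin d)) ∈ unitCube d := fun i => by simp
    have hT0 : extendedCurve d (((q + i : ℕ) : ℝ) / (2 ^ (d * j) : ℕ)) = T 0 := by
      have h1 := hTx 0 (by simp)
      rw [add_zero, hilbertCurve_zero] at h1
      have h2 := add_div_mem_Icc hqi (x := 0) (by simp)
      rw [add_zero] at h2
      rw [extendedCurve_eq h2, ← h1]; push_cast; rfl
    have hTdist : ∀ x ∈ unitCube d, ‖T x - T 0‖ ≤ (1 / 2) ^ j * √d := fun x hx => by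
      rw [hT.norm_sub]
      exact mul_le_mul_of_nonneg_left (norm_sub_le_of_mem_unitCube hx h0) (by positivity)
    have hlow := cell_lower_bound hf hT (g := g (T 0)) (B := ε * ((1 / 2) ^ j * √d))
      (fun x hx => (hlin _ (hTcube _ h0) _ (hTcube _ hx) ((hTdist x hx).trans_lt hr1)).trans
        (mul_le_mul_of_nonneg_left (hTdist x hx) hε)) a (δ := 1 / 16) (by norm_num) (by norm_num)
    have hpull : ∫ x, (along f ((((q + i : ℕ) : ℝ) + x) / (2 ^ (d * j) : ℕ)) - a) ^ 2 ∂unif =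
        ∫ x, (f (T x) - a) ^ 2 ∂unifCube d := by
      rw [← map_extendedCurve, integral_map continuous_extendedCurve.measurable.aemeasurable]
      · refine integral_congr_ae (ae_unif_mem.mono fun x hx => ?_)
        have h2 := add_div_mem_Icc hqi hx
        simp only [along]
        rw [extendedCurve_eq h2, extendedCurve_eq hx, ← hTx x hx]; push_cast; rfl
      · rw [map_extendedCurve, unifCube_eq]
        exact (((hf.comp hT.lipschitzWith.continuous.continuousOn hTcube).sub
          continuousOn_const).pow 2).aestronglyMeasurable isClosed_unitCube.measurableSet
    -- The corner T 0 lies on the curve over the same stratum. Any other point over it is within 2 ·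
    -- 2√d n^{-1/d} < r, by way of the centre z.
    have hgT : G ≤ ‖g (T 0)‖ ^ 2 + η := by
      obtain ⟨z, -, hz⟩ := exists_norm_extendedCurve_sub_le (d := d) hk
      have hy0 : ∃ y ∈ Set.Icc (0 : ℝ) 1, ((k : ℝ) + y) / n =
          ((q + i : ℕ) : ℝ) / (2 ^ (d * j) : ℕ) := by
        have hN' : (0 : ℝ) < (2 ^ (d * j) : ℕ) := by exact_mod_cast hN
        have h1 : (k : ℝ) * (2 ^ (d * j) : ℕ) ≤ ((q + i : ℕ) : ℝ) * n := by
          have : k * 2 ^ (d * j) ≤ (q + i) * n := hq1.trans (Nat.mul_le_mul_right n (by omega))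
          exact_mod_cast this
        have h2 : ((q + i : ℕ) : ℝ) * n ≤ ((k : ℝ) + 1) * (2 ^ (d * j) : ℕ) := by
          have : (q + i) * n ≤ (k + 1) * 2 ^ (d * j) :=
            (Nat.mul_le_mul_right n (by omega)).trans hq2
          exact_mod_cast this
        refine ⟨((q + i : ℕ) : ℝ) * n / (2 ^ (d * j) : ℕ) - k, ⟨?_, ?_⟩, ?_⟩
        · rw [sub_nonneg, le_div_iff₀ hN']; exact h1
        · rw [sub_le_iff_le_add, div_le_iff₀ hN', add_comm (1 : ℝ)]; exact h2
        · field_simp; ring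
      obtain ⟨y₀, hy0, hy0e⟩ := hy0
      have hz0 := hz y₀ hy0
      rw [hy0e, hT0] at hz0
      have hpt : ∀ x ∈ Set.Icc (0 : ℝ) 1,
          ‖g (extendedCurve d (((k : ℝ) + x) / n))‖ ^ 2 ≤ ‖g (T 0)‖ ^ 2 + η := by
        intro x hx
        refine hgrad _ (hTcube _ h0) _ (extendedCurve_mem _) ?_
        have h3 := norm_sub_le_norm_sub_add_norm_sub (extendedCurve d (((k : ℝ) + x) / n)) z (T 0)
        rw [norm_sub_rev z] at h3
        linarith [hz x hx]
      have hcont : Continuous fun x => ‖g (extendedCurve d (((k : ℝ) + x) / n))‖ ^ 2 :=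
        ((hg.comp_continuous (continuous_extendedCurve.comp (by fun_prop))
          fun x => extendedCurve_mem _).norm).pow 2
      have h4 := integral_mono_ae (integrable_unif_of_continuous hcont)
        (integrable_const (‖g (T 0)‖ ^ 2 + η)) (ae_unif_mem.mono hpt)
      simpa using h4
    rw [hpull]
    refine le_trans ?_ hlow
    have hB : (ε * ((1 / 2) ^ j * √d)) ^ 2 / (1 / 16) = (1 / 4) ^ j * (16 * ε ^ 2 * d) := by
      have h5 : ((1 / 2 : ℝ) ^ j) ^ 2 = (1 / 4) ^ j := by
        rw [← pow_mul, mul_comm, pow_mul]; norm_num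
      rw [mul_pow, mul_pow, Real.sq_sqrt (by positivity), h5]; ring
    rw [hB]
    have h6 : (0 : ℝ) < (1 / 4) ^ j := by positivity
    nlinarith
  have hsum := Finset.sum_le_sum hcell
  rw [Finset.sum_const, Finset.card_range, nsmul_eq_mul] at hsum
  calc _ = (n / 2 ^ (d * j) : ℝ) * (c * ((1 / 4) ^ j *
        (15 / 16 * (G - η) / 12 - 16 * ε ^ 2 * d))) := by ring
    _ ≤ _ := by push_cast at hsum ⊢; gcongr

/-- The lower bound for the variance of a stratified estimate along Hilbert's curve. -/
theorem eventually_le_variance_stratifiedMean (hf : ContDiffOn ℝ 1 f (unitCube d))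
    (hσ : 0 < ∫ x in unitCube d, ‖gradientWithin f (unitCube d) x‖ ^ 2) :
    ∀ᶠ n : ℕ in atTop, (∫ x in unitCube d, ‖gradientWithin f (unitCube d) x‖ ^ 2) / 96
          * (2 : ℝ) ^ (-2 / (d : ℝ) - d) * (n : ℝ) ^ (-1 - 2 / (d : ℝ))
        ≤ Var[stratifiedMean (along f) n; Measure.pi fun _ => unif] := by
  have hd : (0 : ℝ) < d := by exact_mod_cast NeZero.pos d
  set g := gradientWithin f (unitCube d) with hgdef
  have hg : ContinuousOn g (unitCube d) := continuousOn_gradientWithin hf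
  have hg2 : ContinuousOn (fun x => ‖g x‖ ^ 2) (unitCube d) := hg.norm.pow 2
  set σ := ∫ x in unitCube d, ‖g x‖ ^ 2 with hσdef
  -- Here σ denotes the theorem's σ². The choice makes the linearization error 16 ε² d equal to
  -- σ/192; with δ = 1/16 and η = σ/16 there remains (15/16)²/12 - 1/192 ≥ 1/16.
  set ε := √(σ / (3072 * d)) with hε
  have hεpos : 0 < ε := Real.sqrt_pos.2 (by positivity)
  have hεd : 16 * ε ^ 2 * d = σ / 192 := by
    rw [hε, Real.sq_sqrt (by positivity)]; field_simp; norm_num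
  obtain ⟨r1, hr1, hlin⟩ := exists_uniform_linear_approx hf hεpos
  obtain ⟨r2, hr2, hgrad⟩ := Metric.uniformContinuousOn_iff.1
    (isCompact_unitCube.uniformContinuousOn_of_continuous hg2) (σ / 16) (by positivity)
  have hlim : Tendsto (fun n : ℕ => 4 * √d * (n : ℝ) ^ (-1 / (d : ℝ))) atTop (𝓝 0) := by
    have h1 : Tendsto (fun n : ℕ => (n : ℝ) ^ (-(1 / (d : ℝ)))) atTop (𝓝 0) :=
      (tendsto_rpow_neg_atTop (by positivity)).comp tendsto_natCast_atTop_atTop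
    simpa [neg_div] using h1.const_mul (4 * √d)
  filter_upwards [hlim.eventually_lt_const (lt_min hr1 hr2), eventually_gt_atTop 0] with n hnr hn
  have hn' : (0 : ℝ) < n := by exact_mod_cast hn
  obtain ⟨j, hj1, hj2⟩ := exists_fine_level d hn
  -- Two whole cells are guaranteed once N = 2^{dj} reaches 3n; otherwise one is, and N < 3n
  -- compensates.
  obtain ⟨c, hc1, hc2⟩ : ∃ c : ℕ, (c = 2 ∨ c = 1 ∧ 2 ^ (d * j) < 3 * n) ∧
      (c + 1) * n ≤ 2 ^ (d * j) := by
    rcases Nat.lt_or_ge (2 ^ (d * j)) (3 * n) with h | h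
    · exact ⟨1, Or.inr ⟨rfl, h⟩, hj1⟩
    · exact ⟨2, Or.inl rfl, h⟩
  have hjr : (1 / 2 : ℝ) ^ j * √d < min r1 r2 := by
    refine lt_of_le_of_lt ?_ hnr
    have h1 : (n : ℝ) ≤ 2 ^ (d * j) := by
      have : n ≤ 2 ^ (d * j) := by omega
      exact_mod_cast this
    have h2 : (n : ℝ) ^ (1 / (d : ℝ)) ≤ 2 ^ j := by
      rw [← two_pow_mul_rpow d j]
      exact Real.rpow_le_rpow hn'.le h1 (by positivity)
    have h3 : 0 < (n : ℝ) ^ (1 / (d : ℝ)) := Real.rpow_pos_of_pos hn' _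
    have h4 : (1 / 2 : ℝ) ^ j ≤ (n : ℝ) ^ (-1 / (d : ℝ)) := by
      rw [neg_div, Real.rpow_neg hn'.le, one_div, inv_pow]
      exact inv_anti₀ h3 h2
    have h5 : 0 ≤ √(d : ℝ) * (n : ℝ) ^ (-1 / (d : ℝ)) := by positivity
    have h6 := mul_le_mul_of_nonneg_right h4 (Real.sqrt_nonneg (d : ℝ))
    linarith
  have hF := continuous_along hf.continuousOn
  have hstr : ∀ k ∈ Finset.range n, _ ≤ Var[fun x => along f (((k : ℝ) + x) / n); unif] :=
    fun k hk => stratum_lower_bound hf.continuousOn hg (Finset.mem_range.1 hk) hc2 hεpos.le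
      (η := σ / 16) (r := min r1 r2)
      (fun x hx y hy hxy => hlin x hx y hy (hxy.trans_le (min_le_left _ _)))
      (fun x hx y hy hxy => by
        have h := hgrad y hy x hx (by rw [dist_eq_norm]; exact hxy.trans_le (min_le_right _ _))
        rw [Real.dist_eq] at h
        linarith [(abs_lt.1 h).2])
      hjr hnr
  have hsum := Finset.sum_le_sum hstr
  rw [← Finset.mul_sum, Finset.sum_sub_distrib, ← Finset.sum_div, ← Finset.mul_sum,
    Finset.sum_sub_distrib, Finset.sum_const, Finset.sum_const, Finset.card_range, nsmul_eq_mul,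
    nsmul_eq_mul, hεd] at hsum
  -- The sum is exact, not a Riemann approximation: the strata partition the unit interval and the
  -- curve preserves measure.
  have hG : ∑ k ∈ Finset.range n, ∫ x, ‖g (extendedCurve d (((k : ℝ) + x) / n))‖ ^ 2 ∂unif =
      n * σ := by
    have h1 := sum_integral_stratum (continuous_along hg2) hn
    rw [integral_along hg2, ← Finset.sum_range fun k : ℕ =>
      ∫ x, along (fun x => ‖g x‖ ^ 2) (((k : ℝ) + x) / n) ∂unif] at h1
    rw [hσdef, ← h1]
    simp only [along]
    field_simp
  rw [hG] at hsum
  rw [variance_stratifiedMean hF]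
  have hfin := fine_level_rpow_le (d := d) hn hj2 hc1
  calc _ = σ * (1 / 96 * (2 : ℝ) ^ (-2 / (d : ℝ) - d) * (n : ℝ) ^ (-1 - 2 / (d : ℝ))) := by ring
    _ ≤ σ * (c / 2 ^ (d * j) * (1 / 4) ^ j / 16) := by gcongr
    _ = (1 / (n : ℝ)) ^ 2 * ((n / 2 ^ (d * j) : ℝ) * c * (1 / 4) ^ j * (n * σ / 16)) := by
        field_simp
    _ ≤ (1 / (n : ℝ)) ^ 2 * ((n / 2 ^ (d * j) : ℝ) * c * (1 / 4) ^ j *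
        (15 / 16 * (n * σ - n * (σ / 16)) / 12 - n * (σ / 192))) := by
        gcongr
        have : 0 < n * σ := by positivity
        linarith
    _ ≤ _ := by gcongr

end LowerBound

/-! ### Uniform smallness of the strata -/

/-- The powers n^{-1/d} cancel against the lower bound for √V, and n^{-1/2} remains. -/
lemma tendsto_stratum_ratio {C c d : ℝ} (hc : 0 < c) {V : ℕ → ℝ}
    (hV : ∀ᶠ n : ℕ in atTop, c * (n : ℝ) ^ (-1 - 2 / d) ≤ V n) (hC : 0 ≤ C) :
    Tendsto (fun n : ℕ => C * (n : ℝ) ^ (-1 / d) / (n * √(V n))) atTop (𝓝 0) := by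
  have hlim : Tendsto (fun n : ℕ => C / √c * (n : ℝ) ^ (-(1 / 2) : ℝ)) atTop (𝓝 0) := by
    simpa using ((tendsto_rpow_neg_atTop (by norm_num : (0 : ℝ) < 1 / 2)).comp
      tendsto_natCast_atTop_atTop).const_mul (C / √c)
  refine tendsto_of_tendsto_of_tendsto_of_le_of_le' tendsto_const_nhds hlim
    (Eventually.of_forall fun n => by positivity) ?_
  filter_upwards [hV, eventually_gt_atTop 0] with n hn hpos
  have hn' : (0 : ℝ) < n := by exact_mod_cast hpos
  have hs : √c * (n : ℝ) ^ (-1 / 2 - 1 / d) ≤ √(V n) := by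
    refine Real.le_sqrt_of_sq_le (le_trans (le_of_eq ?_) hn)
    rw [mul_pow, Real.sq_sqrt hc.le, ← Real.rpow_natCast, ← Real.rpow_mul hn'.le]
    congr 2; push_cast; ring
  have hpow : 0 < (n : ℝ) ^ (-1 / 2 - 1 / d) := Real.rpow_pos_of_pos hn' _
  have hsc : 0 < √c := Real.sqrt_pos.2 hc
  calc _ ≤ C * (n : ℝ) ^ (-1 / d) / (n * (√c * (n : ℝ) ^ (-1 / 2 - 1 / d))) := by gcongr
    _ = C / √c * ((n : ℝ) ^ (-1 / d) / ((n : ℝ) ^ (1 : ℝ) * (n : ℝ) ^ (-1 / 2 - 1 / d))) := by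
        rw [Real.rpow_one]; field_simp
    _ = _ := by
        rw [← Real.rpow_add hn', ← Real.rpow_sub hn']
        congr 2; ring

end HSFC

end

theorem mainTheorem1 {d b : ℕ} [NeZero d] [NeZero b] (hb : 2 ≤ b)
    (f : EuclideanSpace ℝ (Fin d) → ℝ) (hf : ContDiffOn ℝ 1 f (HSFC.unitCube d))
    (hσ : 0 < ∫ x in HSFC.unitCube d, ‖gradientWithin f (HSFC.unitCube d) x‖ ^ 2)
    {Ω : Type*} [MeasurableSpace Ω] (P : Measure Ω) [IsProbabilityMeasure P]
    (π : List (Fin b) → Ω → Equiv.Perm (Fin b)) (hπ : HSFC.IsNestedUniformScrambling P π) :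
    (∀ᶠ m : ℕ in atTop,
      (∫ x in HSFC.unitCube d, ‖gradientWithin f (HSFC.unitCube d) x‖ ^ 2) / 96
          * (2 : ℝ) ^ (-2 / (d : ℝ) - d) * ((b ^ m : ℕ) : ℝ) ^ (-1 - 2 / (d : ℝ))
        ≤ variance (HSFC.estimate f π (b ^ m)) P) ∧
    (∀ M : ℝ≥0, LipschitzOnWith M f (HSFC.unitCube d) → ∀ m : ℕ,
      variance (HSFC.estimate f π (b ^ m)) P
        ≤ 4 * (M : ℝ) ^ 2 * ((d : ℝ) + 3) * ((b ^ m : ℕ) : ℝ) ^ (-1 - 2 / (d : ℝ))) ∧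
    TendstoInDistribution
      (fun (m : ℕ) ω => (HSFC.estimate f π (b ^ m) ω - ∫ x in HSFC.unitCube d, f x)
        / √(variance (HSFC.estimate f π (b ^ m)) P))
      atTop (id : ℝ → ℝ) (fun _ => P) (gaussianReal 0 1) := by
  have hpow : Tendsto (fun m : ℕ => b ^ m) atTop atTop := tendsto_pow_atTop_atTop_of_one_lt hb
  have hvar := hπ.variance_estimate hb hf.continuousOn
  have hlow := HSFC.eventually_le_variance_stratifiedMean hf hσ
  refine ⟨?_, fun M hM m => ?_, ?_⟩
  · filter_upwards [hpow.eventually hlow] with m hm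
    rwa [hvar m]
  · rw [hvar m]
    exact HSFC.variance_stratifiedMean_le hM (pow_pos (NeZero.pos b) m)
  · obtain ⟨M, hM⟩ := HSFC.exists_lipschitzOnWith hf
    -- Any Lipschitz constant of f serves here, since only the order n^{-1/d} of the oscillation
    -- matters.
    refine hπ.tendstoInDistribution hb hf.continuousOn
      (fun m k hk => HSFC.exists_abs_along_sub_le hM hk) ?_ ?_
    · filter_upwards [hpow.eventually hlow] with m hm
      rw [hvar m]
      refine lt_of_lt_of_le ?_ hm
      have : (0 : ℝ) < (b ^ m : ℕ) := by exact_mod_cast pow_pos (NeZero.pos b) m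
      positivity
    · have h := (HSFC.tendsto_stratum_ratio (C := M * (2 * √d)) (by positivity) hlow
        (by positivity)).comp hpow
      refine h.congr fun m => ?_
      simp only [Function.comp, hvar m, mul_assoc]
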